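/- Let $\Delta$ be a Dynkin diagram of type $A_n$ ($n\ge 1$), $D_n$ ($n\ge 4$) or $E_{6,7,8}$ with vertex set $\Delta_0$ (write $\imath\sim\jmath$ for adjacency), and let $\sigma$ be an automorphism of $\Delta$ such that $\imath\not\sim\sigma(\imath)$ for all $\imath\in\Delta_0$. Let $r$ be the order of $\sigma$, $I$ the set of $\sigma$-orbits in $\Delta_0$, $\bar\imath\in I$ the orbit of $\imath$, and $d_i=|i|$ for $i\in I$; write $i\sim j$ if some element of $i$ is adjacent to some element of $j$. Put $c_{ii}=2$, $c_{ij}=-\lceil d_j/d_i\rceil$ if $i\ne j$, $i\sim j$, and $c_{ij}=0$ otherwise; $(c_{ij})_{i,j\in I}$ is the Cartan matrix of a complex simple Lie algebra $\mathfrak g$, and every $\mathfrak g$ arises from a pair $(\Delta,\sigma)$ in this way. The quantum Cartan matrix $C(z)=(C_{ij}(z))_{i,j\in I}$ has entries $C_{ii}(z)=z^{d_i}+z^{-d_i}$ and $C_{ij}(z)=[c_{ij}]_z$ for $i\neq j$, where $[k]_z=(z^k-z^{-k})/(z-z^{-1})$. Let $\widetilde C(z)=C(z)^{-1}$ be its inverse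 over $\mathbb Q(z)$ and let $\widetilde c_{ij}(u)$ be the coefficient of $z^u$ in the Laurent expansion of $\widetilde C_{ij}(z)$ at $z=0$. A Q-datum for $\mathfrak g$ is a triple $\mathcal Q=(\Delta,\sigma,\xi)$ with $\xi:\Delta_0\to\mathbb Z$ such that: (H1) $|\xi_\imath-\xi_\jmath|=d_{\bar\imath}$ whenever $\imath\sim\jmath$ and $d_{\bar\imath}=d_{\bar\jmath}$; (H2) whenever $i\sim j$ in $I$ and $d_i<d_j$, there is a unique $j^\circ\in j$ with $|\xi_\imath-\xi_{j^\circ}|=1$, where $i=\{\imath\}$, and $\xi_{\sigma^l(j^\circ)}=\xi_{j^\circ}-2l$ for $0\le l<r$. Let $P=\bigoplus_{\imath\in\Delta_0}\mathbb Z\varpi_\imath$, $\alpha_\imath=2\varpi_\imath-\sum_{\jmath\sim\imath}\varpi_\jmath$, let $(\ ,\ ):P\times P\to\mathbb Q$ be the symmetric bilinear form with $(\varpi_\imath,\alpha_\jmath)=\delta_{\imath\jmath}$, let $s_\imath(\lambda)=\lambda-(\lambda,\alpha_\imath)\alpha_\imath$, and let $\sigma$ act on $P$ by $\sigma(\varpi_\imath)=\varpi_{\sigma(\imath)}$.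 Let $\widehat\Delta_0=\{(\imath,p)\in\Delta_0\times\mathbb Z : p-\xi_\imath\in 2d_{\bar\imath}\mathbb Z\}$, with an arrow $(\imath,p)\to(\jmath,s)$ if $\imath\sim\jmath$ and $s-p=\min(d_{\bar\imath},d_{\bar\jmath})$. A compatible reading of a finite set $X\subset\widehat\Delta_0$ is a total ordering $(x_1,\dots,x_m)$ of $X$, $x_k=(\imath_k,p_k)$, such that $k<k'$ whenever there is an arrow $x_{k'}\to x_k$; put $w[X]=s_{\imath_1}\cdots s_{\imath_m}$. For $i\in I$ let $i^\circ\in i$ be the element at which $\xi$ is maximal on $i$, and set $$X^\circ=\{(i^\circ,\xi_{i^\circ}) : i\in I\},\qquad X'=\{(\sigma(i^\circ),p)\in\widehat\Delta_0 : i\in I,\ \xi_{\sigma(i^\circ)}<p\le \xi_{i^\circ}-2\}.$$ The generalized twisted Coxeter element is $\tau_{\mathcal Q}=w[X']^{-1}\,\bigl(w[X^\circ]\,\sigma\bigr)\,w[X']\in\operatorname{Aut}(P)$, formed with arbitrary compatible readings of $X^\circ$ and $X'$. Put $\gamma^{\mathcal Q}_\jmath=(1-\tau_{\mathcal Q}^{d_{\bar\jmath}})\varpi_\jmath$.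 Theorem. For every Q-datum $\mathcal Q=(\Delta,\sigma,\xi)$ for $\mathfrak g$, all $i,j\in I$, all $\imath\in i$, $\jmath\in j$ and every integer $u\ge 0$, $$\widetilde c_{ij}(u)=\begin{cases}\bigl(\varpi_\imath,\ \tau_{\mathcal Q}^{(u+\xi_\jmath-\xi_\imath-d_i)/2}(\gamma^{\mathcal Q}_\jmath)\bigr) & \text{if } u+\xi_\jmath-\xi_\imath-d_i\in 2\mathbb Z,\\ 0&\text{otherwise.}\end{cases}$$ -/

import Mathlib

/-! ### Simply-laced Dynkin diagrams -/

open Classical in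
/-- The (symmetric) Cartan matrix `2 - adjacency matrix` of a simply-laced diagram `Δ`. -/
noncomputable def simplyLacedCartan {V : Type*} (Δ : SimpleGraph V) : Matrix V V ℤ :=
  Matrix.of fun v w => if v = w then 2 else if Δ.Adj v w then -1 else 0

/-- `Δ` is, up to a relabelling of its vertices, a Dynkin diagram of one of the types
`A_n` (`n ≥ 1`), `D_n` (`n ≥ 4`), `E_6`, `E_7`, `E_8`. -/
def IsADE {V : Type*} (Δ : SimpleGraph V) : Prop :=
  (∃ n : ℕ, 1 ≤ n ∧ ∃ e : V ≃ Fin n,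
      simplyLacedCartan Δ = (CartanMatrix.A n).submatrix e e) ∨
  (∃ n : ℕ, 4 ≤ n ∧ ∃ e : V ≃ Fin n,
      simplyLacedCartan Δ = (CartanMatrix.D n).submatrix e e) ∨
  (∃ e : V ≃ Fin 6, simplyLacedCartan Δ = CartanMatrix.E₆.submatrix e e) ∨
  (∃ e : V ≃ Fin 7, simplyLacedCartan Δ = CartanMatrix.E₇.submatrix e e) ∨
  (∃ e : V ≃ Fin 8, simplyLacedCartan Δ = CartanMatrix.E₈.submatrix e e)

/-- A pair `(Δ, σ)`: a Dynkin diagram `Δ` of type ADE with vertex set `V`, and an automorphism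
`σ` of `Δ` such that no vertex `v` is adjacent to `σ v`. -/
structure FoldedDiagram (V : Type*) where
  graph : SimpleGraph V
  isADE : IsADE graph
  σ : Equiv.Perm V
  adj_map : ∀ v w : V, graph.Adj (σ v) (σ w) ↔ graph.Adj v w
  not_adj_map : ∀ v : V, ¬ graph.Adj v (σ v)

namespace FoldedDiagram

/-! ### The folded Cartan datum -/

/-- The set `I` of `σ`-orbits of vertices. -/
def Index {V : Type*} (F : FoldedDiagram V) : Type _ :=
  Quotient (Equiv.Perm.SameCycle.setoid F.σ)

/-- The orbit of a vertex. -/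
def orb {V : Type*} (F : FoldedDiagram V) (v : V) : F.Index :=
  Quotient.mk (Equiv.Perm.SameCycle.setoid F.σ) v

instance {V : Type*} [Finite V] (F : FoldedDiagram V) : Finite F.Index :=
  Quotient.finite _

noncomputable instance {V : Type*} [Finite V] (F : FoldedDiagram V) : Fintype F.Index :=
  Fintype.ofFinite _

noncomputable instance {V : Type*} (F : FoldedDiagram V) : DecidableEq F.Index :=
  Classical.decEq _

/-- `r`, the order of `σ`. -/
noncomputable def r {V : Type*} (F : FoldedDiagram V) : ℕ := orderOf F.σ

/-- `d_i`, the cardinality of the orbit `i`. -/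
noncomputable def d {V : Type*} (F : FoldedDiagram V) (i : F.Index) : ℕ :=
  Nat.card {v : V // F.orb v = i}

/-- Adjacency of orbits. -/
def IndexAdj {V : Type*} (F : FoldedDiagram V) (i j : F.Index) : Prop :=
  ∃ v w : V, F.orb v = i ∧ F.orb w = j ∧ F.graph.Adj v w

open Classical in
/-- The Cartan matrix `(c_ij)` of the simple Lie algebra `𝔤` attached to `(Δ, σ)`. -/
noncomputable def c {V : Type*} (F : FoldedDiagram V) (i j : F.Index) : ℤ :=
  if i = j then 2 else if F.IndexAdj i j then -⌈(F.d j : ℚ) / (F.d i : ℚ)⌉ else 0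

end FoldedDiagram

/-- The quantum integer `[k]_z = (z ^ k - z ^ (-k)) / (z - z⁻¹)` in `ℚ(z)`. -/
noncomputable def quantumInt (k : ℤ) : RatFunc ℚ :=
  (RatFunc.X ^ k - RatFunc.X ^ (-k)) / (RatFunc.X - RatFunc.X⁻¹)

namespace FoldedDiagram

/-- The quantum Cartan matrix `C(z)` of `𝔤`, over `ℚ(z)`. -/
noncomputable def quantumCartan {V : Type*} (F : FoldedDiagram V) :
    Matrix F.Index F.Index (RatFunc ℚ) :=
  Matrix.of fun i j =>
    if i = j then RatFunc.X ^ (F.d i : ℤ) + RatFunc.X ^ (-(F.d i : ℤ)) else quantumInt (F.c i j)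

/-- The coefficient of `z ^ u` in the Laurent expansion at `z = 0` of the `(i, j)` entry of the
inverse `C(z)⁻¹` of the quantum Cartan matrix. -/
noncomputable def invQuantumCartanCoeff {V : Type*} [Finite V] (F : FoldedDiagram V)
    (i j : F.Index) (u : ℤ) : ℚ :=
  (((F.quantumCartan)⁻¹ i j : RatFunc ℚ) : LaurentSeries ℚ).coeff u

/-! ### Weight lattice and Weyl group of the ADE diagram

The weight lattice `P` is `V → ℤ`, a weight being given by its coordinates in the basis of
fundamental weights. -/

/-- The fundamental weight `ϖ_v`. -/
def fundWeight {V : Type*} [DecidableEq V] (_F : FoldedDiagram V) (v : V) : V → ℤ :=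
  Pi.single v 1

/-- The simple root `α_v = 2 ϖ_v - ∑_{w ∼ v} ϖ_w`. -/
noncomputable def simpleRoot {V : Type*} (F : FoldedDiagram V) (v : V) : V → ℤ :=
  fun w => simplyLacedCartan F.graph w v

theorem simpleRoot_self {V : Type*} (F : FoldedDiagram V) (v : V) :
    (LinearMap.proj v : (V → ℤ) →ₗ[ℤ] ℤ) (F.simpleRoot v) = 2 := by
  simp [simpleRoot, simplyLacedCartan]

/-- The symmetric bilinear form on `P` with `(ϖ_v, α_w) = δ_{v,w}`: since the matrix of simple
roots in terms of fundamental weights is the Cartan matrix `A`, this is `(λ, μ) = λᵀ A⁻¹ μ`. -/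
noncomputable def form {V : Type*} [Fintype V] [DecidableEq V] (F : FoldedDiagram V)
    (wt wt' : V → ℤ) : ℚ :=
  dotProduct (fun v => (wt v : ℚ))
    (Matrix.mulVec ((simplyLacedCartan F.graph).map (Int.cast : ℤ → ℚ))⁻¹
      (fun v => (wt' v : ℚ)))

/-- The simple reflection `s_v λ = λ - (λ, α_v) α_v`, where `(λ, α_v)` is the coefficient of `ϖ_v`
in `λ`. -/
noncomputable def simpleReflection {V : Type*} (F : FoldedDiagram V) (v : V) :
    (V → ℤ) ≃ₗ[ℤ] (V → ℤ) :=
  Module.reflection (F.simpleRoot_self v)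

/-- The automorphism of `P` induced by `σ`, sending `ϖ_v` to `ϖ_{σ v}`. -/
def sigmaAut {V : Type*} (F : FoldedDiagram V) : (V → ℤ) ≃ₗ[ℤ] (V → ℤ) :=
  LinearEquiv.funCongrLeft ℤ ℤ F.σ.symm

theorem sigmaAut_fundWeight {V : Type*} [DecidableEq V] (F : FoldedDiagram V) (v : V) :
    F.sigmaAut (F.fundWeight v) = F.fundWeight (F.σ v) := by
  funext w
  simp [sigmaAut, fundWeight, LinearEquiv.funCongrLeft, Pi.single_apply, LinearMap.funLeft,
    Equiv.symm_apply_eq]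

end FoldedDiagram

/-! ### Q-data -/

/-- A Q-datum `(Δ, σ, ξ)`: a pair `(Δ, σ)` with a height function `ξ`. -/
structure QDatum (V : Type*) extends FoldedDiagram V where
  ξ : V → ℤ
  height_of_eq : ∀ v w : V, graph.Adj v w →
    toFoldedDiagram.d (toFoldedDiagram.orb v) = toFoldedDiagram.d (toFoldedDiagram.orb w) →
    |ξ v - ξ w| = toFoldedDiagram.d (toFoldedDiagram.orb v)
  height_of_lt : ∀ i j : toFoldedDiagram.Index, toFoldedDiagram.IndexAdj i j →
    toFoldedDiagram.d i < toFoldedDiagram.d j →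
    ∃! w : V, toFoldedDiagram.orb w = j ∧
      (∀ v : V, toFoldedDiagram.orb v = i → |ξ v - ξ w| = 1) ∧
      ∀ l : ℕ, l < toFoldedDiagram.r → ξ ((σ ^ l) w) = ξ w - 2 * (l : ℤ)

namespace QDatum

/-- `d` of the orbit of a vertex. -/
noncomputable def dv {V : Type*} (Q : QDatum V) (v : V) : ℕ := Q.d (Q.orb v)

/-- Vertices of the repetition quiver: pairs `(v, p)` with `p ≡ ξ_v` modulo `2 d_v`. -/
def repVertices {V : Type*} (Q : QDatum V) : Set (V × ℤ) :=
  {x | 2 * (Q.dv x.1 : ℤ) ∣ x.2 - Q.ξ x.1}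

/-- There is an arrow `x → y` in the repetition quiver. -/
def RepArrow {V : Type*} (Q : QDatum V) (x y : V × ℤ) : Prop :=
  x ∈ Q.repVertices ∧ y ∈ Q.repVertices ∧ Q.graph.Adj x.1 y.1 ∧
    y.2 - x.2 = min (Q.dv x.1 : ℤ) (Q.dv y.1 : ℤ)

/-- `l` is a compatible reading of the set `X`: a total ordering `(x_1, …, x_m)` of `X` such that
`k < k'` whenever there is an arrow `x_{k'} → x_k`. -/
def IsCompatibleReading {V : Type*} (Q : QDatum V) (X : Set (V × ℤ)) (l : List (V × ℤ)) : Prop :=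
  l.Nodup ∧ (∀ x, x ∈ l ↔ x ∈ X) ∧
    ∀ k k' : Fin l.length, Q.RepArrow (l.get k') (l.get k) → k < k'

/-- `w = s_{π(x_1)} ⋯ s_{π(x_m)}` for a compatible reading `(x_1, …, x_m)` of `X`,
i.e. `w = w[X]`. -/
def IsWeylElementOf {V : Type*} (Q : QDatum V) (X : Set (V × ℤ))
    (w : (V → ℤ) ≃ₗ[ℤ] (V → ℤ)) : Prop :=
  ∃ l : List (V × ℤ), Q.IsCompatibleReading X l ∧
    w = (l.map fun x => Q.simpleReflection x.1).prod

/-- The set of vertices `i° ∈ i`, for `i ∈ I`, at which `ξ` is maximal on the orbit `i`. -/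
def circVertices {V : Type*} (Q : QDatum V) : Set V :=
  {v | ∀ w : V, Q.orb w = Q.orb v → Q.ξ w ≤ Q.ξ v}

/-- The set `X° = {(i°, ξ_{i°})}`. -/
def circSet {V : Type*} (Q : QDatum V) : Set (V × ℤ) :=
  {x | x.1 ∈ Q.circVertices ∧ x.2 = Q.ξ x.1}

/-- The set `X' = {(σ(i°), p) | ξ_{σ(i°)} < p ≤ ξ_{i°} - 2}` of vertices of the repetition
quiver. -/
def primeSet {V : Type*} (Q : QDatum V) : Set (V × ℤ) :=
  {x | x ∈ Q.repVertices ∧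
    ∃ v ∈ Q.circVertices, x.1 = Q.σ v ∧ Q.ξ (Q.σ v) < x.2 ∧ x.2 ≤ Q.ξ v - 2}

/-- `τ` is the generalized twisted Coxeter element
`τ = w[X']⁻¹ · (w[X°] σ) · w[X']` attached to the Q-datum. -/
def IsGenTwistedCoxeter {V : Type*} (Q : QDatum V) (τ : (V → ℤ) ≃ₗ[ℤ] (V → ℤ)) : Prop :=
  ∃ w₀ w₁ : (V → ℤ) ≃ₗ[ℤ] (V → ℤ),
    Q.IsWeylElementOf Q.circSet w₀ ∧ Q.IsWeylElementOf Q.primeSet w₁ ∧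
      τ = w₁⁻¹ * (w₀ * Q.sigmaAut) * w₁

/-- `γ_v = (1 - τ ^ {d_v}) ϖ_v`. -/
noncomputable def γ {V : Type*} [DecidableEq V] (Q : QDatum V) (τ : (V → ℤ) ≃ₗ[ℤ] (V → ℤ))
    (v : V) : V → ℤ :=
  Q.fundWeight v - (τ ^ Q.dv v) (Q.fundWeight v)

/-- Compatible readings exist. -/
theorem exists_isCompatibleReading {V : Type*} (Q : QDatum V) {X : Set (V × ℤ)} (hX : X.Finite) :
    ∃ l, Q.IsCompatibleReading X l := by
  classical
  let le : V × ℤ → V × ℤ → Bool := fun x y => decide (y.2 ≤ x.2)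
  refine ⟨hX.toFinset.toList.mergeSort le, ?_, ?_, ?_⟩
  · exact (List.mergeSort_perm _ le).nodup_iff.2 (Finset.nodup_toList _)
  · intro x
    simp [(List.mergeSort_perm hX.toFinset.toList le).mem_iff]
  · intro k k' h
    have hp : (hX.toFinset.toList.mergeSort le).Pairwise (fun x y => le x y = true) :=
      List.pairwise_mergeSort (le := le)
        (by intro a b c h1 h2; simp only [le, decide_eq_true_eq] at *; omega)
        (by intro a b; simp only [le, Bool.or_eq_true, decide_eq_true_eq]; omega) _
    by_contra hk
    obtain ⟨-, -, hadj, hd⟩ := h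
    rcases (not_lt.1 hk).lt_or_eq with hlt | heq
    · have h1 := List.pairwise_iff_get.1 hp k' k hlt
      have h1' := of_decide_eq_true h1
      have hpos : ∀ v : V, 0 < Q.dv v := by
        intro v
        have hfin : Finite V := by
          rcases Q.isADE with ⟨_, -, e, -⟩ | ⟨_, -, e, -⟩ | ⟨e, -⟩ | ⟨e, -⟩ | ⟨e, -⟩ <;>
            exact Finite.of_equiv _ e.symm
        have : Nonempty {w : V // Q.orb w = Q.orb v} := ⟨⟨v, rfl⟩⟩
        exact Nat.card_pos
      have h2 : (0 : ℤ) < min (Q.dv ((hX.toFinset.toList.mergeSort le).get k').1 : ℤ)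
          (Q.dv ((hX.toFinset.toList.mergeSort le).get k).1 : ℤ) :=
        lt_min (by exact_mod_cast hpos _) (by exact_mod_cast hpos _)
      rw [← hd] at h2
      exact absurd h1' (not_le.2 (sub_pos.1 h2))
    · rw [heq] at hadj
      exact Q.graph.loopless.irrefl _ hadj

/-- Every Q-datum has a generalized twisted Coxeter element. -/
theorem exists_isGenTwistedCoxeter {V : Type*} [Finite V] (Q : QDatum V) :
    ∃ τ, Q.IsGenTwistedCoxeter τ := by
  have h0 : Q.circSet.Finite :=
    (Set.finite_range fun v : V => (v, Q.ξ v)).subset fun x hx =>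
      ⟨x.1, Prod.ext rfl hx.2.symm⟩
  have h1 : Q.primeSet.Finite := by
    refine (Set.finite_iUnion fun v : V =>
      (Set.finite_Ioc (Q.ξ (Q.σ v)) (Q.ξ v - 2)).image fun p => (Q.σ v, p)).subset ?_
    rintro ⟨x, p⟩ ⟨-, v, -, hv, hp⟩
    exact Set.mem_iUnion.2 ⟨v, p, hp, by rw [← hv]⟩
  obtain ⟨l0, hl0⟩ := Q.exists_isCompatibleReading h0
  obtain ⟨l1, hl1⟩ := Q.exists_isCompatibleReading h1
  exact ⟨_, _, _, ⟨l0, hl0, rfl⟩, ⟨l1, hl1, rfl⟩, rfl⟩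

end QDatum

/-!
The proof constructs the columns of the inverse of the quantum Cartan matrix from the orbit of the
fundamental weights under a twisted Coxeter element.

Write `τ₁ = w[X°] σ` and `Φ_i(p) = τ₁ ^ ((ξ_{i°} - p) / 2) ϖ_{i°}` for an orbit `i` and a height `p`
of the right parity, and `Φ_i(p) = 0` for the other heights (`QDatum.weight`). Since `s_v ϖ_v` is
`-ϖ_v` plus the sum of the fundamental weights of the neighbours of `v`, reading `X°` gives the mesh
relation `QDatum.IsAdapted.mesh`
`Φ_i(p) + Φ_i(p - 2 d_i) = ∑_{j ∼ i} ∑_{t < n_ij} Φ_j(p - m_ij - 2 t)`,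
with `m_ij = min(d_i, d_j)` and `n_ij = ⌈d_j / d_i⌉`. As `-[-n]_z = z^(n-1) + ⋯ + z^(1-n)`, this says
that, after a shift of heights, the sequences `Φ_i` solve `C(z) Φ = 0`.

Fix an orbit `k`, let `A` be the vertices read before `k°`, and let `g` be the product of their
reflections. Then `(1 - τ₁ ^ d_k) ϖ_{k°} = g α_{k°}` (`QDatum.root_eq`), and the pairings
`f_i(p) = (Φ_i(p), g α_{k°})` again solve the mesh relation, in both directions. Consider the slice
formed by the maximal heights that remain once `A` has been read. The `d_j` weights `Φ_j(p)` at and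
directly below the slice are `g ϖ_v`, with `v` running over the orbit `j`, so near the slice `f` is
a delta function at `k` (`QDatum.IsAdapted.pairing_slice`). Cutting `f` off below the slice
therefore produces Laurent series `b_i` with `∑_j C_ij(z) b_j = δ_ik`, which are the `k`-th column
of the inverse; and the part cut off vanishes in degrees `u ≥ 0`, because the mesh relation
determines it from above (`MeshSystem.truncation`).

For the general element `τ = w[X']⁻¹ τ₁ w[X']` it remains to see that `w[X'] ϖ_v = Φ_i(ξ_v)` for
`v` in the orbit `i` (`QDatum.IsAdapted.weight_height`). If `r = 3`, or if the heights of the orbit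
are `ξ_{i°} - 2 l`, no reflection of `X'` touches `v`. If `r = 2`, each element of `X'` lowers the
height of its vertex by `4`, by the mesh relation.

Types A, D and E enter through four properties (`IsGoodCartan`): a positive vector on which the
Cartan matrix is positive, which excludes cycles and affine subdiagrams; connectedness; the
existence of a vertex fixed by `σ`; and `σ ^ 2 = 1` or `σ ^ 3 = 1`.
-/


section

open Finset

/-! ### The Cartan matrices of type A -/

theorem sum_A_mul {n : ℕ} (v : Fin n) (f : ℕ → ℤ) (h0 : f 0 = 0) (hn : f (n + 1) = 0) :
    ∑ w : Fin n, CartanMatrix.A n v w * f (w + 1) = 2 * f (v + 1) - f v - f (v + 2) := by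
  have key : ∀ w : Fin n, CartanMatrix.A n v w * f (w + 1) =
      (if (w : ℕ) = v then 2 * f (v + 1) else 0) - (if (w : ℕ) + 1 = v then f v else 0)
        - (if (w : ℕ) = v + 1 then f (v + 2) else 0) := by
    intro w
    simp only [CartanMatrix.A, Matrix.of_apply, Fin.ext_iff]
    grind
  rw [Finset.sum_congr rfl fun w _ => key w,
    Fin.sum_univ_eq_sum_range (fun w => (if w = (v : ℕ) then 2 * f (v + 1) else 0)
      - (if w + 1 = v then f v else 0) - (if w = v + 1 then f (v + 2) else 0)) n]
  simp only [Finset.sum_sub_distrib]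
  have hv := v.2
  have e1 : (∑ w ∈ range n, if w = (v : ℕ) then 2 * f (v + 1) else 0) = 2 * f (v + 1) := by
    rw [Finset.sum_ite_eq' (range n) (v : ℕ)]; simp
  have e2 : (∑ w ∈ range n, if w + 1 = (v : ℕ) then f v else 0) = f v := by
    rcases Nat.eq_zero_or_pos (v : ℕ) with h | h
    · simp [h, h0]
    · have : ∀ w, (w + 1 = (v : ℕ)) ↔ w = (v : ℕ) - 1 := by omega
      simp only [this]
      rw [Finset.sum_ite_eq' (range n), if_pos (by simp; omega)]
  have e3 : (∑ w ∈ range n, if w = (v : ℕ) + 1 then f (v + 2) else 0) = f (v + 2) := by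
    rw [Finset.sum_ite_eq' (range n)]
    split_ifs with h
    · rfl
    · have : (v : ℕ) + 2 = n + 1 := by simp at h; omega
      rw [this, hn]
  rw [e1, e2, e3]

/-- The properties of a Dynkin diagram of type ADE, with Cartan matrix `M`, on which the argument
rests: a positive vector `y` with `M y` positive, connectedness, and the fact that an automorphism
moving no vertex to a neighbour has a fixed vertex and order dividing `2` or `3`. -/
structure IsGoodCartan {V : Type*} [Fintype V] (M : Matrix V V ℤ) : Prop where
  exists_pos : ∃ y : V → ℤ, (∀ v, 0 < y v) ∧ ∀ v, 0 < ∑ w, M v w * y w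
  connected : ∀ S : V → Prop, (∀ v w, S v → M v w = -1 → S w) → ∀ v w, S v → S w
  exists_fixed : ∀ σ : Equiv.Perm V, (∀ v w, M (σ v) (σ w) = M v w) → (∀ v, M v (σ v) ≠ -1) →
    ∃ v, σ v = v
  pow_eq_one : ∀ σ : Equiv.Perm V, (∀ v w, M (σ v) (σ w) = M v w) → σ ^ 2 = 1 ∨ σ ^ 3 = 1

theorem IsGoodCartan.submatrix {V W : Type*} [Fintype V] [Fintype W] {M : Matrix W W ℤ}
    (h : IsGoodCartan M) (e : V ≃ W) : IsGoodCartan (M.submatrix e e) where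
  exists_pos := by
    obtain ⟨y, h1, h2⟩ := h.exists_pos
    refine ⟨y ∘ e, fun v => h1 _, fun v => ?_⟩
    have := h2 (e v)
    rwa [← e.sum_comp] at this
  connected := by
    intro S hS v w hv
    have := h.connected (fun x => S (e.symm x))
      (fun x y hx hxy => hS _ _ hx (by simpa using hxy)) (e v) (e w) (by simpa using hv)
    simpa using this
  exists_fixed := by
    intro σ h1 h2
    obtain ⟨v, hv⟩ := h.exists_fixed (e.symm.trans (σ.trans e))
      (fun v w => by simpa using h1 (e.symm v) (e.symm w)) (fun v => by simpa using h2 (e.symm v))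
    exact ⟨e.symm v, by simpa [Equiv.eq_symm_apply] using hv⟩
  pow_eq_one := by
    intro σ h1
    have := h.pow_eq_one (e.symm.trans (σ.trans e))
      (fun v w => by simpa using h1 (e.symm v) (e.symm w))
    refine this.imp (fun h => ?_) (fun h => ?_)
    · ext v
      have := congrArg (fun p => p (e v)) h
      simpa [pow_succ] using this
    · ext v
      have := congrArg (fun p => p (e v)) h
      simpa [pow_succ] using this

theorem A_eq_neg_one_iff {n : ℕ} (i j : Fin n) :
    CartanMatrix.A n i j = -1 ↔ (i : ℕ) + 1 = j ∨ (j : ℕ) + 1 = i := by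
  simp only [CartanMatrix.A, Matrix.of_apply, Fin.ext_iff]
  grind

theorem isGoodCartan_A {n : ℕ} (hn : 1 ≤ n) : IsGoodCartan (CartanMatrix.A n) := by
  have main : ∀ σ : Equiv.Perm (Fin n),
      (∀ v w, CartanMatrix.A n (σ v) (σ w) = CartanMatrix.A n v w) →
      (∀ v, σ v = v) ∨ ∀ v, ((σ v : Fin n) : ℕ) + v + 1 = n := by
    intro σ hσ
    have adj : ∀ v w : Fin n, ((v : ℕ) + 1 = w ∨ (w : ℕ) + 1 = v) ↔
        ((σ v : ℕ) + 1 = σ w ∨ (σ w : ℕ) + 1 = σ v) := by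
      intro v w
      rw [← A_eq_neg_one_iff, ← A_eq_neg_one_iff, hσ]
    have inj : ∀ v w : Fin n, (σ v : ℕ) = σ w → (v : ℕ) = w := fun v w h => by
      rw [σ.injective (Fin.ext h)]
    have h0 : ((σ ⟨0, hn⟩ : Fin n) : ℕ) = 0 ∨ ((σ ⟨0, hn⟩ : Fin n) : ℕ) + 1 = n := by
      by_contra! hc
      have hlt := (σ ⟨0, hn⟩).2
      obtain ⟨a, ha⟩ := σ.surjective ⟨(σ ⟨0, hn⟩ : ℕ) - 1, by omega⟩
      obtain ⟨b, hb⟩ := σ.surjective ⟨(σ ⟨0, hn⟩ : ℕ) + 1, by omega⟩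
      have h1 := adj ⟨0, hn⟩ a
      have h2 := adj ⟨0, hn⟩ b
      rw [ha] at h1
      rw [hb] at h2
      have : a = b := Fin.ext (by simp at h1 h2; omega)
      subst this
      rw [ha, Fin.mk.injEq] at hb
      omega
    refine h0.imp (fun h0 => ?_) (fun h0 => ?_)
    · have : ∀ k (hk : k < n), ((σ ⟨k, hk⟩ : Fin n) : ℕ) = k := by
        intro k
        induction k using Nat.strong_induction_on with
        | _ k ih =>
          intro hk
          match k with
          | 0 => exact h0
          | 1 =>
            have := adj ⟨0, hn⟩ ⟨1, hk⟩
            simp at this; omega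
          | k + 2 =>
            have h1 := adj ⟨k + 1, by omega⟩ ⟨k + 2, hk⟩
            have e1 := ih (k + 1) (by omega) (by omega)
            have e2 := ih k (by omega) (by omega)
            have h2 := inj ⟨k, by omega⟩ ⟨k + 2, hk⟩
            simp at h1 h2; omega
      exact fun v => Fin.ext (this v v.2)
    · have : ∀ k (hk : k < n), ((σ ⟨k, hk⟩ : Fin n) : ℕ) + k + 1 = n := by
        intro k
        induction k using Nat.strong_induction_on with
        | _ k ih =>
          intro hk
          have hlt := (σ ⟨k, hk⟩).2
          match k with
          | 0 => simpa using h0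
          | 1 =>
            have := adj ⟨0, hn⟩ ⟨1, hk⟩
            simp at this; omega
          | k + 2 =>
            have h1 := adj ⟨k + 1, by omega⟩ ⟨k + 2, hk⟩
            have e1 := ih (k + 1) (by omega) (by omega)
            have e2 := ih k (by omega) (by omega)
            have h2 := inj ⟨k, by omega⟩ ⟨k + 2, hk⟩
            simp at h1 h2; omega
      exact fun v => this v v.2
  refine ⟨?_, ?_, ?_, ?_⟩
  · refine ⟨fun v => ((v : ℕ) + 1 : ℤ) * (n - (v : ℕ)), fun v => ?_, fun v => ?_⟩
    · have := v.2
      apply mul_pos <;> [positivity; (push_cast; omega)]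
    · have := sum_A_mul v (fun k => (k : ℤ) * (n + 1 - k)) (by simp) (by simp)
      have e : ∀ w : Fin n, CartanMatrix.A n v w * (((w : ℕ) + 1 : ℤ) * (n - (w : ℕ))) =
        CartanMatrix.A n v w * (fun k : ℕ => (k : ℤ) * (n + 1 - k)) (w + 1) := by
        intro w; simp
      rw [Finset.sum_congr rfl fun w _ => e w, this]
      push_cast; ring_nf; norm_num
  · intro S hS
    have up : ∀ k (hk : k < n), S ⟨0, hn⟩ ↔ S ⟨k, hk⟩ := by
      intro k
      induction k with
      | zero => intro _; rfl
      | succ k ih =>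
        intro hk
        rw [ih (by omega)]
        exact ⟨fun h => hS _ _ h ((A_eq_neg_one_iff _ _).2 (by simp)),
          fun h => hS _ _ h ((A_eq_neg_one_iff _ _).2 (by simp))⟩
    intro v w hv
    exact (up w w.2).1 ((up v v.2).2 hv)
  · intro σ h1 h2
    rcases main σ h1 with h | h
    · exact ⟨⟨0, hn⟩, h _⟩
    · have e := h ⟨(n - 1) / 2, by omega⟩
      by_cases hodd : n % 2 = 1
      · exact ⟨⟨(n - 1) / 2, by omega⟩, Fin.ext (by simp at e ⊢; omega)⟩
      · refine absurd ((A_eq_neg_one_iff _ _).2 ?_) (h2 ⟨(n - 1) / 2, by omega⟩)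
        simp at e ⊢; omega
  · intro σ h1
    left
    ext v
    rcases main σ h1 with h | h
    · simp [pow_succ, h]
    · have := h v
      have := h (σ v)
      simp [pow_succ]; omega

/-! ### The Cartan matrices of types D and E -/

theorem Fin.sum_ite_val_eq {n : ℕ} (c : ℕ) (a : ℤ) :
    (∑ w : Fin n, if (w : ℕ) = c then a else 0) = if c < n then a else 0 := by
  rw [Fin.sum_univ_eq_sum_range (fun w => if w = c then a else 0) n, Finset.sum_ite_eq']
  simp

theorem D_eq_neg_one_iff {n : ℕ} (hn : 4 ≤ n) (i j : Fin n) :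
    CartanMatrix.D n i j = -1 ↔
      ((i : ℕ) + 1 = j ∧ (j : ℕ) + 2 < n) ∨ ((j : ℕ) + 1 = i ∧ (i : ℕ) + 2 < n) ∨
      ((i : ℕ) + 3 = n ∧ ((j : ℕ) + 2 = n ∨ (j : ℕ) + 1 = n)) ∨
      ((j : ℕ) + 3 = n ∧ ((i : ℕ) + 2 = n ∨ (i : ℕ) + 1 = n)) := by
  simp only [CartanMatrix.D, Matrix.of_apply, Fin.ext_iff]
  grind

/-- The witness is twice the sum of the positive roots, written in simple roots. -/
theorem D_exists_pos {n : ℕ} (hn : 4 ≤ n) :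
    ∃ y : Fin n → ℤ, (∀ v, 0 < y v) ∧ ∀ v, 0 < ∑ w, CartanMatrix.D n v w * y w := by
  obtain ⟨m, rfl⟩ : ∃ m, n = m + 4 := ⟨n - 4, by omega⟩
  let f : ℕ → ℤ := fun k => if k < m + 2 then 2 * (k + 1) * (2 * m + 6 - k) else (m + 4) * (m + 3)
  have hf : ∀ k : ℕ, f k =
      if k < m + 2 then 2 * ((k : ℤ) + 1) * (2 * m + 6 - k) else ((m : ℤ) + 4) * (m + 3) :=
    fun _ => rfl
  clear_value f
  refine ⟨fun v => f v, fun v => ?_, fun v => ?_⟩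
  · simp only [hf]
    split_ifs
    · apply mul_pos <;> [positivity; omega]
    · positivity
  · have hv := v.2
    rcases lt_or_ge (v : ℕ) (m + 1) with h | h
    · have key : ∀ w : Fin (m + 4), CartanMatrix.D (m + 4) v w * f w =
          (if (w : ℕ) = v then 2 * f v else 0)
          - (if (w : ℕ) = v - 1 then (if 1 ≤ (v : ℕ) then f (v - 1) else 0) else 0)
            - (if (w : ℕ) = v + 1 then f (v + 1) else 0) := by
        intro w
        have hw := w.2
        simp only [CartanMatrix.D, Matrix.of_apply, Fin.ext_iff]
        grind
      rw [Finset.sum_congr rfl fun w _ => key w]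
      simp only [Finset.sum_sub_distrib, Fin.sum_ite_val_eq]
      have f0 : f v = 2 * ((v : ℕ) + 1 : ℤ) * (2 * m + 6 - (v : ℕ)) := by
        rw [hf, if_pos (by omega)]
      have f1 : f (v + 1) = 2 * ((v : ℕ) + 2 : ℤ) * (2 * m + 5 - (v : ℕ)) := by
        rw [hf, if_pos (by omega)]; push_cast; ring
      have f2 : 1 ≤ (v : ℕ) → f (v - 1) = 2 * (v : ℕ) * (2 * m + 7 - (v : ℕ)) := by
        intro h1
        rw [hf, if_pos (by omega)]; push_cast [h1]; ring
      rw [if_pos (by omega : (v : ℕ) < m + 4), if_pos (by omega : (v : ℕ) - 1 < m + 4),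
        if_pos (by omega : (v : ℕ) + 1 < m + 4), f0, f1]
      split_ifs with h0
      · rw [f2 h0]
        ring_nf; norm_num
      · have h0 : ((v : ℕ) : ℤ) = 0 := by omega
        rw [h0]
        ring_nf; norm_num
    · obtain h | h | h : (v : ℕ) = m + 1 ∨ (v : ℕ) = m + 2 ∨ (v : ℕ) = m + 3 := by omega
      · have key : ∀ w : Fin (m + 4), CartanMatrix.D (m + 4) v w * f w =
            (if (w : ℕ) = m + 1 then 2 * f (m + 1) else 0)
            - (if (w : ℕ) = m then f m else 0) - (if (w : ℕ) = m + 2 then f (m + 2) else 0)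
            - (if (w : ℕ) = m + 3 then f (m + 3) else 0) := by
          intro w
          have hw := w.2
          simp only [CartanMatrix.D, Matrix.of_apply, Fin.ext_iff]
          grind
        rw [Finset.sum_congr rfl fun w _ => key w]
        simp only [Finset.sum_sub_distrib, Fin.sum_ite_val_eq, hf]
        simp
        ring_nf; norm_num
      · have key : ∀ w : Fin (m + 4), CartanMatrix.D (m + 4) v w * f w =
            (if (w : ℕ) = m + 2 then 2 * f (m + 2) else 0)
            - (if (w : ℕ) = m + 1 then f (m + 1) else 0) := by
          intro w
          have hw := w.2
          simp only [CartanMatrix.D, Matrix.of_apply, Fin.ext_iff]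
          grind
        rw [Finset.sum_congr rfl fun w _ => key w]
        simp only [Finset.sum_sub_distrib, Fin.sum_ite_val_eq, hf]
        simp
        ring_nf; norm_num
      · have key : ∀ w : Fin (m + 4), CartanMatrix.D (m + 4) v w * f w =
            (if (w : ℕ) = m + 3 then 2 * f (m + 3) else 0)
            - (if (w : ℕ) = m + 1 then f (m + 1) else 0) := by
          intro w
          have hw := w.2
          simp only [CartanMatrix.D, Matrix.of_apply, Fin.ext_iff]
          grind
        rw [Finset.sum_congr rfl fun w _ => key w]
        simp only [Finset.sum_sub_distrib, Fin.sum_ite_val_eq, hf]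
        simp
        ring_nf; norm_num

theorem D_perm_branch {n : ℕ} (hn : 4 ≤ n) (σ : Equiv.Perm (Fin n))
    (hσ : ∀ v w, CartanMatrix.D n (σ v) (σ w) = CartanMatrix.D n v w) :
    σ ⟨n - 3, by omega⟩ = ⟨n - 3, by omega⟩ := by
  have adj : ∀ v w : Fin n, CartanMatrix.D n v w = -1 → CartanMatrix.D n (σ v) (σ w) = -1 :=
    fun v w h => by rw [hσ, h]
  have inj : ∀ v w : Fin n, (v : ℕ) ≠ w → (σ v : ℕ) ≠ σ w := fun v w h e =>
    h (by rw [σ.injective (Fin.ext e)])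
  have h1 := adj ⟨n - 3, by omega⟩ ⟨n - 4, by omega⟩
    ((D_eq_neg_one_iff hn _ _).2 (by simp; omega))
  have h2 := adj ⟨n - 3, by omega⟩ ⟨n - 2, by omega⟩
    ((D_eq_neg_one_iff hn _ _).2 (by simp; omega))
  have h3 := adj ⟨n - 3, by omega⟩ ⟨n - 1, by omega⟩
    ((D_eq_neg_one_iff hn _ _).2 (by simp; omega))
  have i1 := inj ⟨n - 4, by omega⟩ ⟨n - 2, by omega⟩ (by simp; omega)
  have i2 := inj ⟨n - 4, by omega⟩ ⟨n - 1, by omega⟩ (by simp; omega)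
  have i3 := inj ⟨n - 1, by omega⟩ ⟨n - 2, by omega⟩ (by simp; omega)
  rw [D_eq_neg_one_iff hn] at h1 h2 h3
  exact Fin.ext (by simp only; omega)

theorem D_perm_pow {n : ℕ} (hn : 4 ≤ n) (σ : Equiv.Perm (Fin n))
    (hσ : ∀ v w, CartanMatrix.D n (σ v) (σ w) = CartanMatrix.D n v w) :
    σ ^ 2 = 1 ∨ σ ^ 3 = 1 := by
  rcases hn.eq_or_lt with rfl | hn5
  · have key : ∀ σ : Equiv.Perm (Fin 4), σ 1 = 1 → σ ^ 2 = 1 ∨ σ ^ 3 = 1 := by decide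
    exact key σ (D_perm_branch hn σ hσ)
  left
  have adj : ∀ v w : Fin n, CartanMatrix.D n v w = -1 → CartanMatrix.D n (σ v) (σ w) = -1 :=
    fun v w h => by rw [hσ, h]
  have inj : ∀ v w : Fin n, (v : ℕ) ≠ w → (σ v : ℕ) ≠ σ w := fun v w h e =>
    h (by rw [σ.injective (Fin.ext e)])
  have hb := D_perm_branch hn σ hσ
  simp only [D_eq_neg_one_iff hn] at adj
  -- the neighbour of the branch vertex which is not a leaf is fixed
  have hx : (σ ⟨n - 4, by omega⟩ : ℕ) = n - 4 := by
    have h1 := adj ⟨n - 3, by omega⟩ ⟨n - 4, by omega⟩ (by simp only; omega)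
    have h2 := adj ⟨n - 4, by omega⟩ ⟨n - 5, by omega⟩ (by simp only; omega)
    have h3 := inj ⟨n - 3, by omega⟩ ⟨n - 5, by omega⟩ (by simp; omega)
    rw [hb] at h1 h3
    simp only at h1 h2 h3
    omega
  have chain : ∀ k (hk : k + 3 ≤ n), (σ ⟨n - 3 - k, by omega⟩ : ℕ) = n - 3 - k := by
    intro k
    induction k using Nat.strong_induction_on with
    | _ k ih =>
      intro hk
      match k with
      | 0 => simp [hb]
      | 1 => exact hx
      | k + 2 =>
        have e1 := ih (k + 1) (by omega) (by omega)
        have e2 := ih k (by omega) (by omega)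
        have h1 := adj ⟨n - 3 - (k + 1), by omega⟩ ⟨n - 3 - (k + 2), by omega⟩
          (by simp only; omega)
        have h2 := inj ⟨n - 3 - k, by omega⟩ ⟨n - 3 - (k + 2), by omega⟩ (by simp; omega)
        omega
  have chain' : ∀ v : Fin n, (v : ℕ) + 3 ≤ n → σ v = v := by
    intro v hv
    have := chain (n - 3 - v) (by omega)
    have e : (⟨n - 3 - (n - 3 - v), by omega⟩ : Fin n) = v := Fin.ext (by simp only; omega)
    rw [e] at this
    exact Fin.ext (by omega)
  have leaf : ∀ v : Fin n, n < (v : ℕ) + 3 → n < (σ v : ℕ) + 3 := by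
    intro v hv
    by_contra hc
    have := chain' (σ v) (by omega)
    have := σ.injective this
    rw [this] at hc
    exact hc hv
  ext v
  simp only [pow_two, Equiv.Perm.coe_mul, Function.comp_apply, Equiv.Perm.one_apply]
  rcases le_or_gt ((v : ℕ) + 3) n with h | h
  · rw [chain' v h, chain' v h]
  · have h1 := leaf v h
    have h2 := leaf _ h1
    by_cases e : σ v = v
    · rw [e, e]
    · have e2 : σ (σ v) ≠ σ v := fun h => e (σ.injective h)
      have a1 := v.2
      have a2 := (σ v).2
      have a3 := (σ (σ v)).2
      rw [Fin.ext_iff] at e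
      rw [Ne, Fin.ext_iff] at e2
      omega

theorem isGoodCartan_D {n : ℕ} (hn : 4 ≤ n) : IsGoodCartan (CartanMatrix.D n) := by
  refine ⟨D_exists_pos hn, ?_, fun σ h _ => ⟨_, D_perm_branch hn σ h⟩, D_perm_pow hn⟩
  intro S hS
  have up : ∀ k (hk : k + 3 ≤ n), S ⟨n - 3, by omega⟩ ↔ S ⟨n - 3 - k, by omega⟩ := by
    intro k
    induction k with
    | zero => intro _; rfl
    | succ k ih =>
      intro hk
      rw [ih (by omega)]
      exact ⟨fun h => hS _ _ h ((D_eq_neg_one_iff hn _ _).2 (by simp; omega)),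
        fun h => hS _ _ h ((D_eq_neg_one_iff hn _ _).2 (by simp; omega))⟩
  have all : ∀ v : Fin n, S ⟨n - 3, by omega⟩ ↔ S v := by
    intro v
    rcases le_or_gt ((v : ℕ) + 3) n with h | h
    · have := up (n - 3 - v) (by omega)
      have e : (⟨n - 3 - (n - 3 - v), by omega⟩ : Fin n) = v := Fin.ext (by simp only; omega)
      rwa [e] at this
    · have := v.2
      exact ⟨fun h => hS _ _ h ((D_eq_neg_one_iff hn _ _).2 (by simp; omega)),
        fun h => hS _ _ h ((D_eq_neg_one_iff hn _ _).2 (by simp; omega))⟩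
  intro v w hv
  exact (all w).1 ((all v).2 hv)

/-- Adjacency in the diagrams of type `E`, with vertices numbered from `0` in Bourbaki's order. -/
def EAdj (i j : ℕ) : Prop :=
  (i = 0 ∧ j = 2) ∨ (i = 2 ∧ j = 0) ∨ (i = 1 ∧ j = 3) ∨ (i = 3 ∧ j = 1) ∨ (i = 2 ∧ j = 3) ∨
    (i = 3 ∧ j = 2) ∨ (3 ≤ i ∧ j = i + 1) ∨ (3 ≤ j ∧ i = j + 1)

instance (i j : ℕ) : Decidable (EAdj i j) := by unfold EAdj; infer_instance

theorem EAdj.eq_three {b x y z : ℕ} (hx : EAdj b x) (hy : EAdj b y) (hz : EAdj b z) (h1 : x ≠ y)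
    (h2 : x ≠ z) (h3 : y ≠ z) : b = 3 := by
  unfold EAdj at *
  omega

theorem EAdj.of_three {x : ℕ} (hx : EAdj 3 x) : x = 1 ∨ x = 2 ∨ x = 4 := by
  unfold EAdj at *
  omega

theorem E_perm {n : ℕ} (hn : 6 ≤ n) (M : Matrix (Fin n) (Fin n) ℤ)
    (hM : ∀ i j, M i j = -1 ↔ EAdj i j) (σ : Equiv.Perm (Fin n))
    (hσ : ∀ v w, M (σ v) (σ w) = M v w) :
    σ ⟨3, by omega⟩ = ⟨3, by omega⟩ ∧ σ ^ 2 = 1 := by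
  have adj : ∀ v w : Fin n, EAdj v w → EAdj (σ v) (σ w) :=
    fun v w h => by rwa [← hM, hσ, hM]
  have inj : ∀ v w : Fin n, (v : ℕ) ≠ w → (σ v : ℕ) ≠ σ w := fun v w h e =>
    h (by rw [σ.injective (Fin.ext e)])
  have hb : (σ ⟨3, by omega⟩ : ℕ) = 3 :=
    EAdj.eq_three (adj ⟨3, by omega⟩ ⟨1, by omega⟩ (by simp [EAdj]))
      (adj ⟨3, by omega⟩ ⟨2, by omega⟩ (by simp [EAdj]))
      (adj ⟨3, by omega⟩ ⟨4, by omega⟩ (by simp [EAdj]))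
      (inj _ _ (by simp)) (inj _ _ (by simp)) (inj _ _ (by simp))
  -- the leaf next to the branch vertex has no second neighbour, unlike the other two
  have h2 : (σ ⟨2, by omega⟩ : ℕ) = 2 ∨ (σ ⟨2, by omega⟩ : ℕ) = 4 := by
    have h1 := adj ⟨3, by omega⟩ ⟨2, by omega⟩ (by simp [EAdj])
    have h2 := adj ⟨2, by omega⟩ ⟨0, by omega⟩ (by simp [EAdj])
    have h3 := inj ⟨3, by omega⟩ ⟨0, by omega⟩ (by simp)
    rw [hb] at h1 h3
    have := h1.of_three
    unfold EAdj at h2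
    omega
  have h4 : (σ ⟨4, by omega⟩ : ℕ) = 2 ∨ (σ ⟨4, by omega⟩ : ℕ) = 4 := by
    have h1 := adj ⟨3, by omega⟩ ⟨4, by omega⟩ (by simp [EAdj])
    have h2 := adj ⟨4, by omega⟩ ⟨5, by omega⟩ (by simp [EAdj])
    have h3 := inj ⟨3, by omega⟩ ⟨5, by omega⟩ (by simp)
    rw [hb] at h1 h3
    have := h1.of_three
    unfold EAdj at h2
    omega
  have h24 := inj ⟨2, by omega⟩ ⟨4, by omega⟩ (by simp)
  refine ⟨Fin.ext hb, ?_⟩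
  have adj2 : ∀ v w : Fin n, EAdj v w → EAdj (σ (σ v)) (σ (σ w)) :=
    fun v w h => adj _ _ (adj _ _ h)
  have inj2 : ∀ v w : Fin n, (v : ℕ) ≠ w → (σ (σ v) : ℕ) ≠ σ (σ w) := fun v w h =>
    inj _ _ (inj _ _ h)
  have up : ∀ v : Fin n, ∀ k (hk : k < n), (v : ℕ) = k → v = ⟨k, hk⟩ := fun v k hk h => Fin.ext h
  have g3 : (σ (σ ⟨3, by omega⟩) : ℕ) = 3 := by rw [up _ 3 (by omega) hb]; exact hb
  have g2 : (σ (σ ⟨2, by omega⟩) : ℕ) = 2 := by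
    rcases h2 with h | h <;> rw [up _ _ (by omega) h] <;> omega
  have g4 : (σ (σ ⟨4, by omega⟩) : ℕ) = 4 := by
    rcases h4 with h | h <;> rw [up _ _ (by omega) h] <;> omega
  have g0 : (σ (σ ⟨0, by omega⟩) : ℕ) = 0 := by
    have h1 := adj2 ⟨2, by omega⟩ ⟨0, by omega⟩ (by simp [EAdj])
    have h3 := inj2 ⟨3, by omega⟩ ⟨0, by omega⟩ (by simp)
    rw [g2] at h1
    unfold EAdj at h1
    omega
  have g1 : (σ (σ ⟨1, by omega⟩) : ℕ) = 1 := by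
    have h1 := adj2 ⟨3, by omega⟩ ⟨1, by omega⟩ (by simp [EAdj])
    have i1 := inj2 ⟨1, by omega⟩ ⟨2, by omega⟩ (by simp)
    have i2 := inj2 ⟨1, by omega⟩ ⟨4, by omega⟩ (by simp)
    rw [g3] at h1
    have := h1.of_three
    omega
  have chain : ∀ k (hk : k < n), (σ (σ ⟨k, hk⟩) : ℕ) = k := by
    intro k
    induction k using Nat.strong_induction_on with
    | _ k ih =>
      intro hk
      match k with
      | 0 => exact g0
      | 1 => exact g1
      | 2 => exact g2
      | 3 => exact g3
      | 4 => exact g4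
      | k + 5 =>
        have e1 := ih (k + 4) (by omega) (by omega)
        have e2 := ih (k + 3) (by omega) (by omega)
        have h1 := adj2 ⟨k + 4, by omega⟩ ⟨k + 5, by omega⟩ (by simp [EAdj])
        have h2 := inj2 ⟨k + 3, by omega⟩ ⟨k + 5, by omega⟩ (by simp)
        rw [e1] at h1
        unfold EAdj at h1
        omega
  ext v
  simpa [pow_two] using chain v v.2

theorem isGoodCartan_of_EAdj {n : ℕ} (hn : 6 ≤ n) (M : Matrix (Fin n) (Fin n) ℤ)
    (hM : ∀ i j, M i j = -1 ↔ EAdj i j)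
    (hy : ∃ y : Fin n → ℤ, (∀ v, 0 < y v) ∧ ∀ v, 0 < ∑ w, M v w * y w) : IsGoodCartan M := by
  refine ⟨hy, ?_, fun σ h _ => ⟨_, (E_perm hn M hM σ h).1⟩,
    fun σ h => Or.inl (E_perm hn M hM σ h).2⟩
  intro S hS
  have step : ∀ v w : Fin n, EAdj v w → (S v ↔ S w) := fun v w h =>
    ⟨fun hv => hS _ _ hv ((hM _ _).2 h), fun hv => hS _ _ hv ((hM _ _).2 (by
      unfold EAdj at *; omega))⟩
  have up : ∀ k (hk : k < n), S ⟨3, by omega⟩ ↔ S ⟨k, hk⟩ := by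
    have u2 := step ⟨3, by omega⟩ ⟨2, by omega⟩ (by simp [EAdj])
    intro k
    induction k with
    | zero => intro _; exact u2.trans (step _ _ (by simp [EAdj]))
    | succ k ih =>
      intro hk
      match k with
      | 0 => exact step _ _ (by simp [EAdj])
      | 1 => exact u2
      | 2 => rfl
      | k + 3 => exact (ih (by omega)).trans (step _ _ (by simp [EAdj]))
  intro v w hv
  exact (up w w.2).1 ((up v v.2).2 hv)

/-- Here and for the other diagrams of type `E` the positive vector is the sum of the positive
roots, written in simple roots. -/
theorem isGoodCartan_E₆ : IsGoodCartan CartanMatrix.E₆ :=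
  isGoodCartan_of_EAdj le_rfl _
    (by intro i j; fin_cases i <;> fin_cases j <;> decide)
    ⟨![16, 22, 30, 42, 30, 16], by decide, by decide⟩

theorem isGoodCartan_E₇ : IsGoodCartan CartanMatrix.E₇ :=
  isGoodCartan_of_EAdj (by norm_num) _
    (by intro i j; fin_cases i <;> fin_cases j <;> decide)
    ⟨![34, 49, 66, 96, 75, 52, 27], by decide, by decide⟩

theorem isGoodCartan_E₈ : IsGoodCartan CartanMatrix.E₈ :=
  isGoodCartan_of_EAdj (by norm_num) _
    (by intro i j; fin_cases i <;> fin_cases j <;> decide)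
    ⟨![92, 136, 182, 270, 220, 168, 114, 58], by decide, by decide⟩

theorem IsADE.isGoodCartan {V : Type*} [Fintype V] {Δ : SimpleGraph V} (h : IsADE Δ) :
    IsGoodCartan (simplyLacedCartan Δ) := by
  rcases h with ⟨n, hn, e, h⟩ | ⟨n, hn, e, h⟩ | ⟨e, h⟩ | ⟨e, h⟩ | ⟨e, h⟩ <;> rw [h]
  · exact (isGoodCartan_A hn).submatrix e
  · exact (isGoodCartan_D hn).submatrix e
  · exact isGoodCartan_E₆.submatrix e
  · exact isGoodCartan_E₇.submatrix e
  · exact isGoodCartan_E₈.submatrix e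

/-! ### Simply-laced Cartan matrices and orbits of diagram automorphisms -/

section Cartan

variable {V : Type*} (Δ : SimpleGraph V)

theorem simplyLacedCartan_self (v : V) : simplyLacedCartan Δ v v = 2 := by
  simp [simplyLacedCartan]

theorem simplyLacedCartan_comm (v w : V) :
    simplyLacedCartan Δ v w = simplyLacedCartan Δ w v := by
  simp only [simplyLacedCartan, Matrix.of_apply]
  by_cases h : v = w
  · simp [h]
  · by_cases h' : Δ.Adj v w <;> simp [h, Ne.symm h, h', Δ.adj_comm w v]

theorem simplyLacedCartan_eq_neg_one_iff (v w : V) :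
    simplyLacedCartan Δ v w = -1 ↔ Δ.Adj v w := by
  simp only [simplyLacedCartan, Matrix.of_apply]
  split_ifs with h1 h2
  · simp [h1]
  · simpa using h2
  · simpa using h2

open Classical in
theorem sum_simplyLacedCartan_mul [Fintype V] {R : Type*} [CommRing R] (x : V → R) (v : V) :
    ∑ w, (simplyLacedCartan Δ v w : R) * x w = 2 * x v - ∑ w with Δ.Adj v w, x w := by
  have : ∀ w, (simplyLacedCartan Δ v w : R) * x w =
      (if w = v then 2 * x v else 0) - if Δ.Adj v w then x w else 0 := by
    intro w
    simp only [simplyLacedCartan, Matrix.of_apply]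
    by_cases h : v = w
    · subst h; simp
    · by_cases h' : Δ.Adj v w <;> simp [h, h', Ne.symm h]
  rw [Finset.sum_congr rfl fun w _ => this w, Finset.sum_sub_distrib, Finset.sum_ite_eq',
    Finset.sum_filter]
  simp

end Cartan

namespace FoldedDiagram

section Basic

variable {V : Type*} (F : FoldedDiagram V)

theorem pow_r : F.σ ^ F.r = 1 := pow_orderOf_eq_one _

theorem adj_pow (k : ℕ) {v w : V} : F.graph.Adj ((F.σ ^ k) v) ((F.σ ^ k) w) ↔ F.graph.Adj v w := by
  induction k with
  | zero => simp
  | succ k ih => rw [pow_succ', Equiv.Perm.mul_apply, Equiv.Perm.mul_apply, F.adj_map, ih]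

theorem orb_eq_orb {v w : V} : F.orb v = F.orb w ↔ F.σ.SameCycle v w :=
  Quotient.eq (r := Equiv.Perm.SameCycle.setoid F.σ)

variable {F} in
theorem IndexAdj.symm {i j : F.Index} (h : F.IndexAdj i j) : F.IndexAdj j i := by
  obtain ⟨v, w, h1, h2, h3⟩ := h
  exact ⟨w, v, h2, h1, h3.symm⟩

theorem orb_surjective : Function.Surjective F.orb := Quotient.exists_rep

@[simp] theorem orb_pow (k : ℕ) (v : V) : F.orb ((F.σ ^ k) v) = F.orb v :=
  F.orb_eq_orb.2 (Equiv.Perm.sameCycle_pow_left.2 (Equiv.Perm.SameCycle.refl _ _))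

@[simp] theorem orb_map (v : V) : F.orb (F.σ v) = F.orb v := F.orb_pow 1 v

theorem pow_apply_of_fixed {v : V} (h : F.σ v = v) (k : ℕ) : (F.σ ^ k) v = v := by
  induction k with
  | zero => rfl
  | succ k ih => rw [pow_succ, Equiv.Perm.mul_apply, h, ih]

theorem cartan_map (v w : V) :
    simplyLacedCartan F.graph (F.σ v) (F.σ w) = simplyLacedCartan F.graph v w := by
  simp only [simplyLacedCartan, Matrix.of_apply]
  by_cases h : v = w
  · simp [h]
  · by_cases h' : F.graph.Adj v w <;> simp [h, h', F.adj_map]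

end Basic

variable {V : Type*} [Fintype V] (F : FoldedDiagram V)

theorem isGoodCartan : IsGoodCartan (simplyLacedCartan F.graph) := F.isADE.isGoodCartan

theorem exists_fixed : ∃ v, F.σ v = v :=
  F.isGoodCartan.exists_fixed F.σ F.cartan_map
    fun v h => F.not_adj_map v ((simplyLacedCartan_eq_neg_one_iff _ _ _).1 h)

/-- A set of vertices closed under adjacency is empty or everything. -/
theorem forall_of_adj_closed {S : V → Prop} (hS : ∀ v w, S v → F.graph.Adj v w → S w) {v : V}
    (hv : S v) (w : V) : S w :=
  F.isGoodCartan.connected S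
    (fun v w h h' => hS v w h ((simplyLacedCartan_eq_neg_one_iff _ _ _).1 h')) v w hv

/-- A nonnegative vector on which the Cartan matrix is nonpositive along the support vanishes.
This rules out cycles and other subdiagrams which are not of finite type. -/
theorem eq_zero_of_subharmonic {x : V → ℤ} (h0 : ∀ v, 0 ≤ x v)
    (h : ∀ v, 0 < x v → ∑ w, simplyLacedCartan F.graph v w * x w ≤ 0) (v : V) : x v = 0 := by
  obtain ⟨y, hy, hAy⟩ := F.isGoodCartan.exists_pos
  have hle : ∀ v, ∑ w, simplyLacedCartan F.graph v w * x w ≤ 0 := by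
    intro v
    rcases (h0 v).lt_or_eq with hv | hv
    · exact h v hv
    · refine Finset.sum_nonpos fun w _ => ?_
      by_cases e : v = w
      · rw [← e, ← hv]; simp
      · refine mul_nonpos_of_nonpos_of_nonneg ?_ (h0 w)
        simp only [simplyLacedCartan, Matrix.of_apply, if_neg e]
        split_ifs <;> simp
  have e : ∑ v, x v * ∑ w, simplyLacedCartan F.graph v w * y w =
      ∑ v, y v * ∑ w, simplyLacedCartan F.graph v w * x w := by
    simp only [Finset.mul_sum]
    rw [Finset.sum_comm]
    refine Finset.sum_congr rfl fun a _ => Finset.sum_congr rfl fun b _ => ?_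
    rw [simplyLacedCartan_comm]
    ring
  have h1 : ∑ v, y v * ∑ w, simplyLacedCartan F.graph v w * x w ≤ 0 :=
    Finset.sum_nonpos fun v _ => mul_nonpos_of_nonneg_of_nonpos (hy v).le (hle v)
  rw [← e] at h1
  have h2 := (Finset.sum_eq_zero_iff_of_nonneg
    (fun v _ => mul_nonneg (h0 v) (hAy v).le)).1 (le_antisymm h1
      (Finset.sum_nonneg fun v _ => mul_nonneg (h0 v) (hAy v).le)) v (Finset.mem_univ v)
  exact (mul_eq_zero.1 h2).resolve_right (hAy v).ne'

/-- Rescaling the columns by the positive vector `y` makes the Cartan matrix diagonally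
dominant. -/
theorem det_cartan_ne_zero [DecidableEq V] :
    ((simplyLacedCartan F.graph).map (Int.cast : ℤ → ℚ)).det ≠ 0 := by
  obtain ⟨y, hy, hAy⟩ := F.isGoodCartan.exists_pos
  set M := (simplyLacedCartan F.graph).map (Int.cast : ℤ → ℚ) with hM
  have : (M * Matrix.diagonal fun v => (y v : ℚ)).det ≠ 0 := by
    refine det_ne_zero_of_sum_row_lt_diag fun v => ?_
    have h1 := hAy v
    rw [← Finset.add_sum_erase _ _ (Finset.mem_univ v), simplyLacedCartan_self] at h1
    have h2 : ∀ w ∈ Finset.univ.erase v, ‖(M * Matrix.diagonal fun v => (y v : ℚ)) v w‖ =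
        ((-(simplyLacedCartan F.graph v w * y w) : ℤ) : ℝ) := by
      intro w hw
      have hne : v ≠ w := (Finset.ne_of_mem_erase hw).symm
      rw [Matrix.mul_diagonal, hM, Matrix.map_apply]
      simp only [simplyLacedCartan, Matrix.of_apply, if_neg hne]
      have hyw := (hy w).le
      split_ifs
      · simp [Int.norm_eq_abs, hyw]
      · simp
    rw [Finset.sum_congr rfl h2, Matrix.mul_diagonal, hM, Matrix.map_apply,
      simplyLacedCartan_self, ← Int.cast_sum]
    have h3 : ‖((2 : ℤ) : ℚ) * (y v : ℚ)‖ = ((2 * y v : ℤ) : ℝ) := by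
      have h4 : ‖(2 : ℚ)‖ = 2 := by rw [← Rat.norm_cast_real]; norm_num
      simp [Int.norm_eq_abs, (hy v).le, h4]
    rw [h3, Finset.sum_neg_distrib]
    exact_mod_cast (by linarith)
  rw [Matrix.det_mul] at this
  exact left_ne_zero_of_mul this

theorem r_cases : F.r = 1 ∨ F.r = 2 ∨ F.r = 3 := by
  rcases F.isGoodCartan.pow_eq_one F.σ F.cartan_map with h | h
  · have := (Nat.dvd_prime Nat.prime_two).1 (orderOf_dvd_of_pow_eq_one h)
    unfold r; omega
  · have := (Nat.dvd_prime Nat.prime_three).1 (orderOf_dvd_of_pow_eq_one h)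
    unfold r; omega

theorem one_lt_r {v : V} (h : F.σ v ≠ v) : 1 < F.r := by
  rcases F.r_cases with h1 | h1 | h1
  · have := F.pow_r
    rw [h1, pow_one] at this
    exact absurd (by rw [this]; rfl) h
  all_goals omega

theorem pow_apply_ne {v : V} (h : F.σ v ≠ v) {k : ℕ} (h0 : 0 < k) (hk : k < F.r) :
    (F.σ ^ k) v ≠ v := by
  intro e
  obtain rfl | ⟨rfl, hr⟩ : k = 1 ∨ k = 2 ∧ F.r = 3 := by have := F.r_cases; omega
  · exact h e
  · have h3 := F.pow_r
    rw [hr, pow_succ'] at h3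
    have := congrArg (fun p => p v) h3
    simp only [Equiv.Perm.mul_apply, e, Equiv.Perm.one_apply] at this
    exact h this

theorem pow_apply_inj {v : V} (h : F.σ v ≠ v) {k l : ℕ} (hk : k < F.r) (hl : l < F.r)
    (e : (F.σ ^ k) v = (F.σ ^ l) v) : k = l := by
  wlog hlt : k < l generalizing k l
  · rcases (not_lt.1 hlt).lt_or_eq with h' | h'
    · exact (this hl hk e.symm h').symm
    · exact h'.symm
  exfalso
  obtain ⟨m, rfl⟩ := Nat.exists_eq_add_of_lt hlt
  rw [add_assoc, pow_add, Equiv.Perm.mul_apply] at e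
  exact F.pow_apply_ne h (Nat.succ_pos m) (by omega) ((F.σ ^ k).injective e).symm

theorem exists_pow_lt_r {v w : V} (h : F.orb w = F.orb v) : ∃ k < F.r, w = (F.σ ^ k) v := by
  obtain ⟨n, hn⟩ := (F.orb_eq_orb.1 h.symm)
  have hr : 0 < F.r := by have := F.r_cases; omega
  have h0 : (0 : ℤ) < F.r := by exact_mod_cast hr
  refine ⟨(n % F.r).toNat, ?_, ?_⟩
  · have h1 := Int.emod_lt_of_pos n h0
    have h2 := Int.emod_nonneg n h0.ne'
    omega
  · have h2 := Int.emod_nonneg n h0.ne'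
    rw [← hn, ← zpow_natCast, Int.toNat_of_nonneg h2]
    change _ = (F.σ ^ (n % (orderOf F.σ : ℤ))) v
    rw [zpow_mod_orderOf]

theorem orb_eq_orb_of_fixed {v w : V} (h : F.σ v = v) : F.orb w = F.orb v ↔ w = v := by
  refine ⟨fun e => ?_, fun e => by rw [e]⟩
  obtain ⟨k, -, rfl⟩ := F.exists_pow_lt_r e
  exact F.pow_apply_of_fixed h k

theorem d_of_fixed {v : V} (h : F.σ v = v) : F.d (F.orb v) = 1 := by
  have : Unique {w : V // F.orb w = F.orb v} :=
    { default := ⟨v, rfl⟩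
      uniq := fun w => Subtype.ext ((F.orb_eq_orb_of_fixed h).1 w.2) }
  exact Nat.card_unique

theorem d_of_not_fixed {v : V} (h : F.σ v ≠ v) : F.d (F.orb v) = F.r := by
  have : Function.Bijective
      (fun k : Fin F.r => (⟨(F.σ ^ (k : ℕ)) v, F.orb_pow k v⟩ : {w : V // F.orb w = F.orb v})) := by
    constructor
    · intro k l e
      exact Fin.ext (F.pow_apply_inj h k.2 l.2 (congrArg Subtype.val e))
    · rintro ⟨w, hw⟩
      obtain ⟨k, hk, e⟩ := F.exists_pow_lt_r hw
      exact ⟨⟨k, hk⟩, Subtype.ext e.symm⟩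
  unfold d
  rw [← Nat.card_congr (Equiv.ofBijective _ this), Nat.card_fin]

theorem d_eq_one_iff (v : V) : F.d (F.orb v) = 1 ↔ F.σ v = v := by
  refine ⟨fun h => ?_, F.d_of_fixed⟩
  by_contra hv
  have := F.one_lt_r hv
  rw [F.d_of_not_fixed hv] at h
  omega

theorem d_pos (i : F.Index) : 0 < F.d i := by
  obtain ⟨v, rfl⟩ := F.orb_surjective i
  by_cases h : F.σ v = v
  · rw [F.d_of_fixed h]; exact one_pos
  · rw [F.d_of_not_fixed h]; have := F.one_lt_r h; omega

theorem d_le_r (i : F.Index) : F.d i ≤ F.r := by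
  obtain ⟨v, rfl⟩ := F.orb_surjective i
  by_cases h : F.σ v = v
  · rw [F.d_of_fixed h]; have := F.r_cases; omega
  · rw [F.d_of_not_fixed h]

theorem pow_d_apply (v : V) : (F.σ ^ F.d (F.orb v)) v = v := by
  by_cases h : F.σ v = v
  · exact F.pow_apply_of_fixed h _
  · rw [F.d_of_not_fixed h, F.pow_r]; rfl

theorem exists_pow_lt_d {v w : V} (h : F.orb w = F.orb v) :
    ∃ k < F.d (F.orb v), w = (F.σ ^ k) v := by
  by_cases hv : F.σ v = v
  · exact ⟨0, F.d_pos _, (F.orb_eq_orb_of_fixed hv).1 h⟩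
  · rw [F.d_of_not_fixed hv]; exact F.exists_pow_lt_r h

theorem pow_apply_inj_of_lt_d {v : V} {k l : ℕ} (hk : k < F.d (F.orb v)) (hl : l < F.d (F.orb v))
    (e : (F.σ ^ k) v = (F.σ ^ l) v) : k = l := by
  by_cases hv : F.σ v = v
  · rw [F.d_of_fixed hv] at hk hl; omega
  · rw [F.d_of_not_fixed hv] at hk hl; exact F.pow_apply_inj hv hk hl e

theorem fixed_iff_of_orb_eq {v w : V} (h : F.orb v = F.orb w) : F.σ v = v ↔ F.σ w = w := by
  rw [← F.d_eq_one_iff, ← F.d_eq_one_iff, h]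

theorem orb_ne_of_adj {v w : V} (h : F.graph.Adj v w) : F.orb w ≠ F.orb v := by
  intro e
  obtain ⟨k, hk, rfl⟩ := F.exists_pow_lt_r e
  obtain rfl | rfl | ⟨rfl, hr⟩ : k = 0 ∨ k = 1 ∨ k = 2 ∧ F.r = 3 := by
    have := F.r_cases; omega
  · exact h.ne rfl
  · exact F.not_adj_map v h
  · have h3 := F.pow_r
    rw [hr] at h3
    have h4 := (F.adj_map _ _).2 h
    rw [← Equiv.Perm.mul_apply, ← pow_succ', h3] at h4
    exact F.not_adj_map v h4.symm

theorem cartan_sum_le {x : V → ℤ} (h0 : ∀ v, 0 ≤ x v) (z : V) (s : Finset V)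
    (hs : ∀ a ∈ s, F.graph.Adj z a) :
    ∑ w, simplyLacedCartan F.graph z w * x w ≤ 2 * x z - ∑ a ∈ s, x a := by
  classical
  have := sum_simplyLacedCartan_mul F.graph x z
  simp only [Int.cast_id] at this
  rw [this]
  have : ∑ a ∈ s, x a ≤ ∑ w with F.graph.Adj z w, x w :=
    Finset.sum_le_sum_of_subset_of_nonneg (fun a ha => by simpa using hs a ha)
      fun a _ _ => h0 a
  linarith

/-- Two neighbours of a non-fixed vertex in one orbit agree, because otherwise the two orbits would
support a cycle. -/
theorem eq_of_adj_of_orb_eq {v w w' : V} (hv : F.σ v ≠ v) (h : F.graph.Adj v w)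
    (h' : F.graph.Adj v w') (e : F.orb w' = F.orb w) : w' = w := by
  classical
  by_contra hne
  have hw : F.σ w ≠ w := fun hw => hne ((F.orb_eq_orb_of_fixed hw).1 e)
  obtain ⟨l, hl, rfl⟩ := F.exists_pow_lt_r e
  have hl0 : l ≠ 0 := by rintro rfl; exact hne rfl
  have hvl : (F.σ ^ l) v ≠ v := F.pow_apply_ne hv (Nat.pos_of_ne_zero hl0) hl
  let x : V → ℤ := fun z => if F.orb z = F.orb v ∨ F.orb z = F.orb w then 1 else 0
  have hx0 : ∀ z, 0 ≤ x z := fun z => by simp only [x]; split_ifs <;> norm_num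
  have two : ∀ z a b, x z = 1 → F.graph.Adj z a → F.graph.Adj z b → a ≠ b → x a = 1 → x b = 1 →
      ∑ w, simplyLacedCartan F.graph z w * x w ≤ 0 := by
    intro z a b hz ha hb hab hxa hxb
    have := F.cartan_sum_le hx0 z {a, b} (by simp [ha, hb])
    rw [Finset.sum_pair hab, hz, hxa, hxb] at this
    linarith
  have := F.eq_zero_of_subharmonic hx0 (fun z hz => ?_) v
  · simp [x] at this
  · have hz1 : F.orb z = F.orb v ∨ F.orb z = F.orb w := by
      by_contra hc
      simp [x, hc] at hz
    rcases hz1 with hz1 | hz1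
    · obtain ⟨k, -, rfl⟩ := F.exists_pow_lt_r hz1
      exact two _ ((F.σ ^ k) w) ((F.σ ^ k) ((F.σ ^ l) w)) (by simp [x]) ((F.adj_pow k).2 h)
        ((F.adj_pow k).2 h') (fun e => hne ((F.σ ^ k).injective e).symm) (by simp [x])
        (by simp [x])
    · obtain ⟨k, -, rfl⟩ := F.exists_pow_lt_r (hz1.trans e.symm)
      exact two _ ((F.σ ^ k) v) ((F.σ ^ k) ((F.σ ^ l) v)) (by simp [x]) ((F.adj_pow k).2 h'.symm)
        ((F.adj_pow k).2 ((F.adj_pow l).2 h.symm)) (fun e => hvl ((F.σ ^ k).injective e).symm)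
        (by simp [x]) (by simp [x])

/-- For an automorphism of order `3` every non-fixed vertex has a fixed neighbour: the weights
`3, 2, 1` on a chain of orbits would be those of an affine diagram of type `E₆`. -/
theorem exists_fixed_adj_of_r_eq_three (hr : F.r = 3) {w : V} (hw : F.σ w ≠ w) :
    ∃ u, F.σ u = u ∧ F.graph.Adj u w := by
  classical
  obtain ⟨b, hb⟩ := F.exists_fixed
  refine (F.forall_of_adj_closed
    (S := fun w => F.σ w = w ∨ ∃ u, F.σ u = u ∧ F.graph.Adj u w) ?_ (Or.inl hb) w).resolve_left hw
  clear hw w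
  intro w v hw hwv
  by_cases hwf : F.σ w = w
  · exact Or.inr ⟨w, hwf, hwv⟩
  obtain ⟨u, hu, huw⟩ := hw.resolve_left hwf
  left
  by_contra hv
  let x : V → ℤ := fun z => if z = u then 3 else if F.orb z = F.orb w then 2 else
    if F.orb z = F.orb v then 1 else 0
  have hx0 : ∀ z, 0 ≤ x z := fun z => by simp only [x]; split_ifs <;> norm_num
  have hwu : ∀ k, (F.σ ^ k) w ≠ u := fun k e => by
    rw [← e, ← Equiv.Perm.mul_apply, ← pow_succ', pow_succ, Equiv.Perm.mul_apply] at hu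
    exact hwf ((F.σ ^ k).injective hu)
  have hvu : ∀ k, (F.σ ^ k) v ≠ u := fun k e => by
    rw [← e, ← Equiv.Perm.mul_apply, ← pow_succ', pow_succ, Equiv.Perm.mul_apply] at hu
    exact hv ((F.σ ^ k).injective hu)
  have xu : x u = 3 := by simp [x]
  have xw : ∀ k, x ((F.σ ^ k) w) = 2 := fun k => by simp [x, hwu]
  have xv : ∀ k, x ((F.σ ^ k) v) = 1 := fun k => by simp [x, hvu, F.orb_ne_of_adj hwv]
  have uw : ∀ k, F.graph.Adj u ((F.σ ^ k) w) := fun k => by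
    have := (F.adj_pow k).2 huw
    rwa [F.pow_apply_of_fixed hu] at this
  have := F.eq_zero_of_subharmonic hx0 (fun z hz => ?_) u
  · rw [xu] at this; norm_num at this
  by_cases hzu : z = u
  · rw [hzu]
    have inj : Set.InjOn (fun k => (F.σ ^ k) w) (Finset.range 3) := fun k hk l hl e =>
      F.pow_apply_inj hwf (by simpa [hr] using hk) (by simpa [hr] using hl) e
    have := F.cartan_sum_le hx0 u ((Finset.range 3).image fun k => (F.σ ^ k) w)
      (fun a ha => by obtain ⟨k, -, rfl⟩ := Finset.mem_image.1 ha; exact uw k)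
    rw [Finset.sum_image inj, Finset.sum_congr rfl fun k _ => xw k, xu] at this
    simpa using this
  · by_cases hzw : F.orb z = F.orb w
    · obtain ⟨k, -, rfl⟩ := F.exists_pow_lt_r hzw
      have := F.cartan_sum_le hx0 ((F.σ ^ k) w) {u, (F.σ ^ k) v} (by
        simp only [Finset.mem_insert, Finset.mem_singleton]
        rintro a (rfl | rfl)
        · exact (uw k).symm
        · exact (F.adj_pow k).2 hwv)
      rw [Finset.sum_pair (hvu k).symm, xu, xw, xv] at this
      simpa using this
    · have hzv : F.orb z = F.orb v := by
        by_contra hc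
        simp [x, hzu, hzw, hc] at hz
      obtain ⟨k, -, rfl⟩ := F.exists_pow_lt_r hzv
      have := F.cartan_sum_le hx0 ((F.σ ^ k) v) {(F.σ ^ k) w} (by
        simp only [Finset.mem_singleton]
        rintro a rfl
        exact (F.adj_pow k).2 hwv.symm)
      rw [Finset.sum_singleton, xw, xv] at this
      simpa using this

end FoldedDiagram

/-! ### Height functions and adapted readings -/

namespace QDatum

section Basic

variable {V : Type*} (Q : QDatum V)

/-- `m i j` is the smaller of the sizes of two orbits. -/
noncomputable def m (i j : Q.Index) : ℤ := min (Q.d i : ℤ) (Q.d j : ℤ)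

theorem m_comm (i j : Q.Index) : Q.m i j = Q.m j i := min_comm _ _

theorem IsCompatibleReading.pairwise {Q : QDatum V} {X : Set (V × ℤ)} {l : List (V × ℤ)}
    (h : Q.IsCompatibleReading X l) : l.Pairwise fun x y => ¬ Q.RepArrow x y := by
  rw [List.pairwise_iff_get]
  intro k k' hk harr
  exact absurd (h.2.2 k' k harr) (not_lt.2 hk.le)

end Basic

variable {V : Type*} [Fintype V] (Q : QDatum V)

theorem exists_height_of_fixed_adj {v w : V} (hv : Q.σ v = v) (hw : Q.σ w ≠ w)
    (h : Q.graph.Adj v w) : ∃ w', Q.orb w' = Q.orb w ∧ |Q.ξ v - Q.ξ w'| = 1 ∧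
      ∀ l < Q.r, Q.ξ ((Q.σ ^ l) w') = Q.ξ w' - 2 * (l : ℤ) := by
  obtain ⟨w', ⟨h1, h2, h3⟩, -⟩ := Q.height_of_lt (Q.orb v) (Q.orb w) ⟨v, w, rfl, rfl, h⟩ (by
    rw [Q.d_of_fixed hv, Q.d_of_not_fixed hw]; exact Q.one_lt_r hw)
  exact ⟨w', h1, h2 v rfl, h3⟩

theorem height_of_not_fixed {v w : V} (hv : Q.σ v ≠ v) (hw : Q.σ w ≠ w) (h : Q.graph.Adj v w) :
    |Q.ξ v - Q.ξ w| = Q.r := by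
  have := Q.height_of_eq v w h (by rw [Q.d_of_not_fixed hv, Q.d_of_not_fixed hw])
  rwa [Q.d_of_not_fixed hv] at this

theorem height_of_fixed {v w : V} (hv : Q.σ v = v) (hw : Q.σ w = w) (h : Q.graph.Adj v w) :
    |Q.ξ v - Q.ξ w| = 1 := by
  have := Q.height_of_eq v w h (by rw [Q.d_of_fixed hv, Q.d_of_fixed hw])
  rwa [Q.d_of_fixed hv] at this

/-- The repetition quiver is stable under `(v, p) ↦ (σ v, p - 2)`. -/
theorem two_mul_d_dvd_height_map (v : V) :
    2 * (Q.d (Q.orb v) : ℤ) ∣ Q.ξ (Q.σ v) - Q.ξ v + 2 := by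
  obtain ⟨b, hb⟩ := Q.exists_fixed
  refine Q.forall_of_adj_closed (S := fun v => 2 * (Q.d (Q.orb v) : ℤ) ∣ Q.ξ (Q.σ v) - Q.ξ v + 2)
    (v := b) ?_ (by simp [hb, Q.d_of_fixed hb]) v
  clear hb b v
  intro v w hv hvw
  by_cases hw : Q.σ w = w
  · simp [hw, Q.d_of_fixed hw]
  rw [Q.d_of_not_fixed hw]
  by_cases hvf : Q.σ v = v
  · obtain ⟨w', h1, -, h3⟩ := Q.exists_height_of_fixed_adj hvf hw hvw
    obtain ⟨l, hl, rfl⟩ := Q.exists_pow_lt_r h1.symm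
    rw [← Equiv.Perm.mul_apply, ← pow_succ', h3 l hl]
    rcases (Nat.succ_le_of_lt hl).lt_or_eq with hl' | hl'
    · rw [h3 (l + 1) hl']
      exact ⟨0, by push_cast; ring⟩
    · rw [show l + 1 = Q.r from hl', Q.pow_r]
      refine ⟨1, ?_⟩
      rw [← hl', Equiv.Perm.one_apply]
      push_cast; ring
  · rw [Q.d_of_not_fixed hvf] at hv
    obtain ⟨a, ha⟩ := hv
    have e1 := Q.height_of_not_fixed hvf hw hvw
    have e2 := Q.height_of_not_fixed (v := Q.σ v) (w := Q.σ w) (fun e => hvf (Q.σ.injective e))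
      (fun e => hw (Q.σ.injective e)) ((Q.adj_map _ _).2 hvw)
    rcases eq_or_eq_neg_of_abs_eq e1 with h1 | h1 <;>
      rcases eq_or_eq_neg_of_abs_eq e2 with h2 | h2
    · exact ⟨a, by linarith⟩
    · exact ⟨a + 1, by linarith⟩
    · exact ⟨a - 1, by linarith⟩
    · exact ⟨a, by linarith⟩

theorem two_mul_d_dvd_height_pow (v : V) (k : ℕ) :
    2 * (Q.d (Q.orb v) : ℤ) ∣ Q.ξ ((Q.σ ^ k) v) - Q.ξ v + 2 * k := by
  induction k with
  | zero => simp
  | succ k ih =>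
    have := Q.two_mul_d_dvd_height_map ((Q.σ ^ k) v)
    rw [Q.orb_pow] at this
    rw [pow_succ', Equiv.Perm.mul_apply]
    obtain ⟨a, ha⟩ := ih
    obtain ⟨b, hb⟩ := this
    exact ⟨a + b, by rw [Nat.cast_succ]; linarith⟩

theorem two_dvd_height_sub {v w : V} (h : Q.orb v = Q.orb w) : (2 : ℤ) ∣ Q.ξ v - Q.ξ w := by
  obtain ⟨k, -, rfl⟩ := Q.exists_pow_lt_r h
  have := (dvd_mul_right (2 : ℤ) _).trans (Q.two_mul_d_dvd_height_pow w k)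
  omega

theorem exists_mem_circVertices (i : Q.Index) : ∃ v ∈ Q.circVertices, Q.orb v = i := by
  classical
  obtain ⟨v, rfl⟩ := Q.orb_surjective i
  obtain ⟨w, hw, hmax⟩ := (Finset.univ.filter fun w => Q.orb w = Q.orb v).exists_max_image Q.ξ
    ⟨v, by simp⟩
  have hw' : Q.orb w = Q.orb v := by simpa using hw
  exact ⟨w, fun z hz => hmax z (by simpa using hz.trans hw'), hw'⟩

/-- The vertex `i°` of the orbit `i` at which the height is maximal. -/
noncomputable def circ (i : Q.Index) : V := (Q.exists_mem_circVertices i).choose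

/-- The maximal height on the orbit `i`. -/
noncomputable def ht (i : Q.Index) : ℤ := Q.ξ (Q.circ i)

theorem circ_mem (i : Q.Index) : Q.circ i ∈ Q.circVertices :=
  (Q.exists_mem_circVertices i).choose_spec.1

@[simp] theorem orb_circ (i : Q.Index) : Q.orb (Q.circ i) = i :=
  (Q.exists_mem_circVertices i).choose_spec.2

theorem height_le_ht (v : V) : Q.ξ v ≤ Q.ht (Q.orb v) :=
  Q.circ_mem (Q.orb v) v (by simp)

theorem height_injOn_orb {v w : V} (h : Q.orb v = Q.orb w) (e : Q.ξ v = Q.ξ w) : v = w := by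
  obtain ⟨k, hk, rfl⟩ := Q.exists_pow_lt_d h
  have h1 := Q.two_mul_d_dvd_height_pow w k
  rw [e, sub_self, zero_add] at h1
  have h2 := Int.dvd_of_mul_dvd_mul_left two_ne_zero h1
  have h3 := Nat.eq_zero_of_dvd_of_lt (Int.natCast_dvd_natCast.1 h2) hk
  simp [h3]

theorem mem_circVertices_iff {v : V} : v ∈ Q.circVertices ↔ v = Q.circ (Q.orb v) := by
  refine ⟨fun h => Q.height_injOn_orb (by simp) ?_, fun h => by rw [h]; exact Q.circ_mem _⟩
  exact le_antisymm (Q.height_le_ht v) (h _ (by simp))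

theorem circ_injective : Function.Injective Q.circ := fun i j h => by
  rw [← Q.orb_circ i, h, Q.orb_circ]

theorem height_le_ht_sub_two {v : V} (h : v ≠ Q.circ (Q.orb v)) :
    Q.ξ v ≤ Q.ht (Q.orb v) - 2 := by
  have h1 := Q.height_le_ht v
  have h2 : (2 : ℤ) ∣ Q.ξ v - Q.ht (Q.orb v) := Q.two_dvd_height_sub (by simp)
  have h3 : Q.ξ v ≠ Q.ht (Q.orb v) := fun e => h (Q.height_injOn_orb (by simp) e)
  omega

theorem circ_of_fixed {v : V} (h : Q.σ v = v) : Q.circ (Q.orb v) = v :=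
  (Q.orb_eq_orb_of_fixed h).1 (by simp)

theorem ht_of_fixed {v : V} (h : Q.σ v = v) : Q.ht (Q.orb v) = Q.ξ v := by
  rw [ht, Q.circ_of_fixed h]

theorem ht_of_fixed_adj {v w : V} (hv : Q.σ v = v) (hw : Q.σ w ≠ w) (h : Q.graph.Adj v w) :
    |Q.ξ v - Q.ht (Q.orb w)| = 1 ∧
      ∀ l < Q.r, Q.ξ ((Q.σ ^ l) (Q.circ (Q.orb w))) = Q.ht (Q.orb w) - 2 * (l : ℤ) := by
  obtain ⟨w', h1, h2, h3⟩ := Q.exists_height_of_fixed_adj hv hw h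
  have : w' = Q.circ (Q.orb w) := by
    rw [← h1]
    refine Q.mem_circVertices_iff.1 fun z hz => ?_
    obtain ⟨l, hl, rfl⟩ := Q.exists_pow_lt_r hz
    rw [h3 l hl]
    omega
  rw [← this, ht, ← this]
  exact ⟨h2, h3⟩

theorem fixed_circ_iff (v : V) : Q.σ (Q.circ (Q.orb v)) = Q.circ (Q.orb v) ↔ Q.σ v = v :=
  Q.fixed_iff_of_orb_eq (by simp)

theorem abs_ht_sub_of_fixed {v w : V} (h : Q.graph.Adj v w) (hf : Q.σ v = v ∨ Q.σ w = w) :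
    |Q.ht (Q.orb v) - Q.ht (Q.orb w)| = 1 := by
  by_cases hv : Q.σ v = v
  · rw [Q.ht_of_fixed hv]
    by_cases hw : Q.σ w = w
    · rw [Q.ht_of_fixed hw]; exact Q.height_of_fixed hv hw h
    · exact (Q.ht_of_fixed_adj hv hw h).1
  · have hw := hf.resolve_left hv
    rw [Q.ht_of_fixed hw, abs_sub_comm]
    exact (Q.ht_of_fixed_adj hw hv h.symm).1

/-- An orbit adjacent to `v` has a member adjacent to any given member of the orbit of `v`. -/
theorem exists_adj_of_orb_eq {v w v' : V} (h : Q.graph.Adj v w) (e : Q.orb v' = Q.orb v) :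
    ∃ w', Q.orb w' = Q.orb w ∧ Q.graph.Adj v' w' := by
  obtain ⟨k, -, rfl⟩ := Q.exists_pow_lt_r e
  exact ⟨(Q.σ ^ k) w, by simp, (Q.adj_pow k).2 h⟩

theorem adj_of_fixed {v w w' : V} (h : Q.graph.Adj v w) (hv : Q.σ v = v)
    (e : Q.orb w' = Q.orb w) : Q.graph.Adj v w' := by
  obtain ⟨k, -, rfl⟩ := Q.exists_pow_lt_r e
  have := (Q.adj_pow k).2 h
  rwa [Q.pow_apply_of_fixed hv] at this

theorem ht_le_add_r {v w : V} (h : Q.graph.Adj v w) (hv : Q.σ v ≠ v) (hw : Q.σ w ≠ w) :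
    Q.ht (Q.orb v) ≤ Q.ht (Q.orb w) + Q.r ∧
      (¬ Q.graph.Adj (Q.circ (Q.orb v)) (Q.circ (Q.orb w)) →
        Q.ht (Q.orb v) ≤ Q.ht (Q.orb w) + Q.r - 2) := by
  obtain ⟨w', h1, h2⟩ := Q.exists_adj_of_orb_eq h (Q.orb_circ (Q.orb v))
  have h3 := Q.height_of_not_fixed ((Q.fixed_circ_iff v).not.2 hv)
    ((Q.fixed_iff_of_orb_eq h1).not.2 hw) h2
  have h4 := (abs_le.1 h3.le).2
  have h5 := Q.height_le_ht w'
  rw [h1] at h5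
  refine ⟨by rw [ht]; linarith, fun hn => ?_⟩
  have h6 := Q.height_le_ht_sub_two (v := w') (fun e => by
    rw [h1] at e; exact hn (e ▸ h2))
  rw [h1] at h6
  rw [ht]; linarith

theorem abs_ht_sub_of_not_adj {v w : V} (h : Q.graph.Adj v w) (hv : Q.σ v ≠ v) (hw : Q.σ w ≠ w)
    (hn : ¬ Q.graph.Adj (Q.circ (Q.orb v)) (Q.circ (Q.orb w))) :
    |Q.ht (Q.orb v) - Q.ht (Q.orb w)| ≤ Q.r - 2 := by
  have h1 := (Q.ht_le_add_r h hv hw).2 hn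
  have h2 := (Q.ht_le_add_r h.symm hw hv).2 fun e => hn e.symm
  rw [abs_le]
  constructor <;> linarith

theorem abs_ht_sub_of_adj_circ {v w : V} (hv : Q.σ v ≠ v) (hw : Q.σ w ≠ w)
    (h : Q.graph.Adj (Q.circ (Q.orb v)) (Q.circ (Q.orb w))) :
    |Q.ht (Q.orb v) - Q.ht (Q.orb w)| = Q.r :=
  Q.height_of_not_fixed ((Q.fixed_circ_iff v).not.2 hv) ((Q.fixed_circ_iff w).not.2 hw) h

theorem m_of_fixed {v w : V} (h : Q.σ v = v ∨ Q.σ w = w) : Q.m (Q.orb v) (Q.orb w) = 1 := by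
  have h1 := Q.d_pos (Q.orb v)
  have h2 := Q.d_pos (Q.orb w)
  unfold m
  rcases h with h | h
  · rw [Q.d_of_fixed h]; omega
  · rw [Q.d_of_fixed h]; omega

theorem m_of_not_fixed {v w : V} (hv : Q.σ v ≠ v) (hw : Q.σ w ≠ w) :
    Q.m (Q.orb v) (Q.orb w) = Q.r := by
  rw [m, Q.d_of_not_fixed hv, Q.d_of_not_fixed hw, min_self]

theorem abs_ht_sub_le {v w : V} (h : Q.graph.Adj v w) :
    |Q.ht (Q.orb v) - Q.ht (Q.orb w)| ≤ Q.m (Q.orb v) (Q.orb w) := by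
  by_cases hf : Q.σ v = v ∨ Q.σ w = w
  · rw [Q.m_of_fixed hf, Q.abs_ht_sub_of_fixed h hf]
  · push Not at hf
    rw [Q.m_of_not_fixed hf.1 hf.2, abs_le]
    have h1 := (Q.ht_le_add_r h hf.1 hf.2).1
    have h2 := (Q.ht_le_add_r h.symm hf.2 hf.1).1
    constructor <;> linarith

theorem two_dvd_ht_sub_sub_m {v w : V} (h : Q.graph.Adj v w) :
    (2 : ℤ) ∣ Q.ht (Q.orb v) - Q.ht (Q.orb w) - Q.m (Q.orb v) (Q.orb w) := by
  by_cases hf : Q.σ v = v ∨ Q.σ w = w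
  · have := Q.abs_ht_sub_of_fixed h hf
    rw [Q.m_of_fixed hf]
    rcases eq_or_eq_neg_of_abs_eq this with h | h <;> omega
  · push Not at hf
    have h1 := Q.height_of_not_fixed hf.1 hf.2 h
    have h2 : (2 : ℤ) ∣ Q.ξ v - Q.ht (Q.orb v) := Q.two_dvd_height_sub (by simp)
    have h3 : (2 : ℤ) ∣ Q.ξ w - Q.ht (Q.orb w) := Q.two_dvd_height_sub (by simp)
    rw [Q.m_of_not_fixed hf.1 hf.2]
    rcases eq_or_eq_neg_of_abs_eq h1 with h | h <;> omega

theorem ht_sub_eq_m_imp_adj {v w : V} (h : Q.graph.Adj v w)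
    (e : |Q.ht (Q.orb v) - Q.ht (Q.orb w)| = Q.m (Q.orb v) (Q.orb w)) :
    Q.graph.Adj (Q.circ (Q.orb v)) (Q.circ (Q.orb w)) := by
  by_cases hf : Q.σ v = v ∨ Q.σ w = w
  · rcases hf with hv | hw
    · rw [Q.circ_of_fixed hv]
      exact Q.adj_of_fixed h hv (by simp)
    · rw [Q.circ_of_fixed hw]
      exact (Q.adj_of_fixed h.symm hw (by simp)).symm
  · push Not at hf
    by_contra hn
    have := Q.abs_ht_sub_of_not_adj h hf.1 hf.2 hn
    rw [e, Q.m_of_not_fixed hf.1 hf.2] at this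
    linarith

/-- An ordering of the vertices `i°` in which the later of two adjacent orbits is not the higher one
by the full amount `m`. Compatible readings of `X°` have this property, by parity of the heights. -/
structure IsAdapted (L : List V) : Prop where
  nodup : L.Nodup
  mem_iff : ∀ v, v ∈ L ↔ v ∈ Q.circVertices
  ht_le : L.Pairwise fun v w => Q.IndexAdj (Q.orb v) (Q.orb w) →
    Q.ht (Q.orb w) ≤ Q.ht (Q.orb v) + Q.m (Q.orb v) (Q.orb w) - 2

theorem isAdapted_of_reading {l : List (V × ℤ)} (h : Q.IsCompatibleReading Q.circSet l) :
    Q.IsAdapted (l.map Prod.fst) := by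
  have hinj : ∀ x ∈ l, ∀ y ∈ l, x.1 = y.1 → x = y := fun x hx y hy e => by
    have h1 := ((h.2.1 x).1 hx).2
    have h2 := ((h.2.1 y).1 hy).2
    exact Prod.ext e (by rw [h1, h2, e])
  refine ⟨h.1.map_on hinj, fun v => ?_, ?_⟩
  · simp only [List.mem_map]
    constructor
    · rintro ⟨x, hx, rfl⟩
      exact ((h.2.1 x).1 hx).1
    · intro hv
      exact ⟨(v, Q.ξ v), (h.2.1 _).2 ⟨hv, rfl⟩, rfl⟩
  · rw [List.pairwise_map]
    refine h.pairwise.imp_of_mem fun {x y} hx hy hxy hadj => ?_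
    obtain ⟨hx1, hx2⟩ := (h.2.1 x).1 hx
    obtain ⟨hy1, hy2⟩ := (h.2.1 y).1 hy
    obtain ⟨v, w, hv, hw, hvw⟩ := hadj
    rw [Q.mem_circVertices_iff] at hx1 hy1
    have e1 : Q.ht (Q.orb x.1) = x.2 := by rw [ht, ← hx1, hx2]
    have e2 : Q.ht (Q.orb y.1) = y.2 := by rw [ht, ← hy1, hy2]
    have h1 := Q.abs_ht_sub_le hvw
    have h2 := Q.two_dvd_ht_sub_sub_m hvw
    have h3 := Q.ht_sub_eq_m_imp_adj hvw
    rw [hv, hw] at h1 h2 h3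
    by_contra hc
    have h4 : Q.ht (Q.orb y.1) - Q.ht (Q.orb x.1) = Q.m (Q.orb x.1) (Q.orb y.1) := by
      have := (abs_le.1 h1).1
      omega
    have h5 := h3 (by rw [abs_sub_comm, h4, abs_of_nonneg]; unfold m; omega)
    rw [← hx1, ← hy1] at h5
    refine hxy ⟨?_, ?_, h5, ?_⟩
    · simp [repVertices, hx2]
    · simp [repVertices, hy2]
    · rw [← e1, ← e2, h4]; rfl

end QDatum

/-! ### Orbit weights and the mesh relation -/

namespace FoldedDiagram

section

variable {V : Type*} (F : FoldedDiagram V)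

theorem simpleReflection_apply (v : V) (x : V → ℤ) :
    F.simpleReflection v x = x - x v • F.simpleRoot v := by
  rw [simpleReflection, Module.reflection_apply]
  rfl

variable [DecidableEq V]

theorem simpleReflection_fundWeight_of_ne {v w : V} (h : w ≠ v) :
    F.simpleReflection v (F.fundWeight w) = F.fundWeight w := by
  rw [simpleReflection_apply, fundWeight, Pi.single_eq_of_ne' h, zero_smul, sub_zero]

theorem prod_simpleReflection_fundWeight {L : List V} {w : V} (h : w ∉ L) :
    (L.map F.simpleReflection).prod (F.fundWeight w) = F.fundWeight w := by
  induction L with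
  | nil => rfl
  | cons v L ih =>
    rw [List.mem_cons, not_or] at h
    rw [List.map_cons, List.prod_cons, LinearEquiv.mul_apply, ih h.2,
      F.simpleReflection_fundWeight_of_ne h.1]

theorem prefix_fundWeight {A B : List V} (hL : (A ++ B).Nodup) {w : V}
    (hw : w ∈ A) : (A.map F.simpleReflection).prod (F.fundWeight w) =
      ((A ++ B).map F.simpleReflection).prod (F.fundWeight w) := by
  rw [List.map_append, List.prod_append, LinearEquiv.mul_apply,
    F.prod_simpleReflection_fundWeight (fun h => List.disjoint_of_nodup_append hL hw h)]

theorem sigmaAut_fundWeight_pow (k : ℕ) (v : V) :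
    F.sigmaAut (F.fundWeight ((F.σ ^ k) v)) = F.fundWeight ((F.σ ^ (k + 1)) v) := by
  rw [sigmaAut_fundWeight, pow_succ', Equiv.Perm.mul_apply]

open Classical in
theorem simpleReflection_fundWeight_self [Fintype V] (v : V) :
    F.simpleReflection v (F.fundWeight v) =
      -F.fundWeight v + ∑ w with F.graph.Adj v w, F.fundWeight w := by
  rw [simpleReflection_apply, fundWeight, Pi.single_eq_same, one_smul]
  ext w
  have : (∑ w with F.graph.Adj v w, F.fundWeight w) w = if F.graph.Adj v w then 1 else 0 := by
    simp [Finset.sum_apply, fundWeight, Pi.single_apply, Finset.sum_ite_eq]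
  rw [Pi.sub_apply, Pi.add_apply, this, Pi.neg_apply, simpleRoot, simplyLacedCartan_comm]
  simp only [simplyLacedCartan, Matrix.of_apply]
  by_cases h : v = w
  · subst h; simp
  · by_cases h' : F.graph.Adj v w <;> simp [h, h', Ne.symm h]

end

variable {V : Type*} [Fintype V] (F : FoldedDiagram V)

theorem exists_adj_of_indexAdj {v : V} {j : F.Index} (h : F.IndexAdj (F.orb v) j) :
    ∃ w, F.orb w = j ∧ F.graph.Adj v w := by
  obtain ⟨v', w', h1, h2, h3⟩ := h
  obtain ⟨k, -, rfl⟩ := F.exists_pow_lt_r h1.symm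
  exact ⟨(F.σ ^ k) w', by simpa using h2, (F.adj_pow k).2 h3⟩

open Classical in
theorem sum_adj_of_not_fixed {M : Type*} [AddCommMonoid M] {v : V} (hv : F.σ v ≠ v)
    (f : F.Index → M) :
    ∑ w with F.graph.Adj v w, f (F.orb w) = ∑ j with F.IndexAdj (F.orb v) j, f j := by
  refine Finset.sum_bij (fun w _ => F.orb w) (fun w hw => ?_) (fun w hw w' hw' e => ?_)
    (fun j hj => ?_) (fun w hw => rfl)
  · simp only [Finset.mem_filter_univ] at hw ⊢
    exact ⟨v, w, rfl, rfl, hw⟩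
  · simp only [Finset.mem_filter_univ] at hw hw'
    exact F.eq_of_adj_of_orb_eq hv hw' hw e
  · simp only [Finset.mem_filter_univ] at hj
    obtain ⟨w, h1, h2⟩ := F.exists_adj_of_indexAdj hj
    exact ⟨w, by simpa using h2, h1⟩

open Classical in
theorem sum_adj_of_fixed {M : Type*} [AddCommMonoid M] {v : V} (hv : F.σ v = v)
    (c : F.Index → V) (hc : ∀ i, F.orb (c i) = i) (f : V → M) :
    ∑ w with F.graph.Adj v w, f w =
      ∑ j with F.IndexAdj (F.orb v) j, ∑ t ∈ range (F.d j), f ((F.σ ^ t) (c j)) := by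
  have hmaps : ∀ w ∈ Finset.univ.filter (F.graph.Adj v),
      F.orb w ∈ Finset.univ.filter (F.IndexAdj (F.orb v)) := by
    intro w hw
    simp only [Finset.mem_filter_univ] at hw ⊢
    exact ⟨v, w, rfl, rfl, hw⟩
  rw [← Finset.sum_fiberwise_of_maps_to hmaps]
  refine Finset.sum_congr rfl fun j hj => ?_
  simp only [Finset.mem_filter_univ] at hj
  have inj : Set.InjOn (fun t => (F.σ ^ t) (c j)) (range (F.d j)) := by
    intro k hk l hl e
    rw [← hc j] at hk hl
    exact F.pow_apply_inj_of_lt_d (by simpa using hk) (by simpa using hl) e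
  rw [← Finset.sum_image (f := f) inj]
  refine Finset.sum_congr ?_ fun _ _ => rfl
  ext w
  simp only [Finset.mem_filter, Finset.mem_univ, true_and, Finset.mem_image, Finset.mem_range]
  constructor
  · rintro ⟨-, hw⟩
    obtain ⟨k, hk, rfl⟩ := F.exists_pow_lt_d (v := c j) (w := w) (by rw [hw, hc])
    exact ⟨k, by rwa [hc] at hk, rfl⟩
  · rintro ⟨t, -, rfl⟩
    refine ⟨?_, by rw [F.orb_pow, hc]⟩
    obtain ⟨w, h1, h2⟩ := F.exists_adj_of_indexAdj hj
    obtain ⟨k, -, e⟩ := F.exists_pow_lt_r (v := w) (w := (F.σ ^ t) (c j))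
      (by rw [F.orb_pow, hc, h1])
    have := (F.adj_pow k).2 h2
    rw [F.pow_apply_of_fixed hv] at this
    rwa [e]

end FoldedDiagram

namespace QDatum

theorem IsAdapted.pow_circ_notMem {V : Type*} [Fintype V] {Q : QDatum V} {L : List V}
    (hL : Q.IsAdapted L) (i : Q.Index) {k : ℕ} (h0 : 0 < k)
    (hk : k < Q.d i) : (Q.σ ^ k) (Q.circ i) ∉ L := by
  rw [hL.mem_iff, mem_circVertices_iff, Q.orb_pow, Q.orb_circ]
  intro e
  have := Q.pow_apply_inj_of_lt_d (v := Q.circ i) (k := k) (l := 0) (by simpa using hk)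
    (by simpa using Q.d_pos i) (by simpa using e)
  omega

variable {V : Type*} [Fintype V] [DecidableEq V] (Q : QDatum V)

/-- The weight attached to the orbit `i` and the height `p`. For the twisted Coxeter element `τ`
read off the vertices `i°` it is `τ ^ ((ξ_{i°} - p) / 2) ϖ_{i°}`; it is set to `0` when the parity
of `p` is wrong. -/
noncomputable def weight (τ : (V → ℤ) ≃ₗ[ℤ] (V → ℤ)) (i : Q.Index) (p : ℤ) : V → ℤ :=
  if (2 : ℤ) ∣ Q.ht i - p then (τ ^ ((Q.ht i - p) / 2)) (Q.fundWeight (Q.circ i)) else 0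

theorem weight_sub_two_mul (τ : (V → ℤ) ≃ₗ[ℤ] (V → ℤ)) (i : Q.Index) (p n : ℤ) :
    Q.weight τ i (p - 2 * n) = (τ ^ n) (Q.weight τ i p) := by
  unfold weight
  by_cases h : (2 : ℤ) ∣ Q.ht i - p
  · rw [if_pos h, if_pos (by omega), ← LinearEquiv.mul_apply, ← zpow_add]
    congr 2
    omega
  · rw [if_neg h, if_neg (by omega), map_zero]

theorem weight_ht (τ : (V → ℤ) ≃ₗ[ℤ] (V → ℤ)) (i : Q.Index) :
    Q.weight τ i (Q.ht i) = Q.fundWeight (Q.circ i) := by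
  simp [weight]

/-- The number of terms contributed by the orbit `j` to the mesh relation of the orbit `i`. For
adjacent orbits it is `⌈d j / d i⌉`. -/
noncomputable def mult (i j : Q.Index) : ℕ := if Q.d i = 1 then Q.d j else 1

/-- The twisted Coxeter element of an adapted list. -/
noncomputable def coxeter (L : List V) : (V → ℤ) ≃ₗ[ℤ] (V → ℤ) :=
  (L.map Q.simpleReflection).prod * Q.sigmaAut

variable {Q} {L : List V}

theorem IsAdapted.weight_of_lt (hL : Q.IsAdapted L) (i : Q.Index) {l : ℕ} (hl : l < Q.d i) :
    Q.weight (Q.coxeter L) i (Q.ht i - 2 * l) = Q.fundWeight ((Q.σ ^ l) (Q.circ i)) := by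
  induction l with
  | zero => simp [weight]
  | succ l ih =>
    rw [show Q.ht i - 2 * ((l + 1 : ℕ) : ℤ) = Q.ht i - 2 * l - 2 * 1 by push_cast; ring,
      weight_sub_two_mul, ih (by omega), zpow_one, coxeter, LinearEquiv.mul_apply,
      Q.sigmaAut_fundWeight_pow,
      Q.prod_simpleReflection_fundWeight (hL.pow_circ_notMem i (Nat.succ_pos l) hl)]

theorem IsAdapted.weight_d (hL : Q.IsAdapted L) (i : Q.Index) :
    Q.weight (Q.coxeter L) i (Q.ht i - 2 * Q.d i) =
      (L.map Q.simpleReflection).prod (Q.fundWeight (Q.circ i)) := by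
  obtain ⟨l, hl⟩ : ∃ l, Q.d i = l + 1 := ⟨Q.d i - 1, by have := Q.d_pos i; omega⟩
  rw [hl, show Q.ht i - 2 * ((l + 1 : ℕ) : ℤ) = Q.ht i - 2 * l - 2 * 1 by push_cast; ring,
    weight_sub_two_mul, hL.weight_of_lt i (by omega), zpow_one, coxeter, LinearEquiv.mul_apply,
    Q.sigmaAut_fundWeight_pow, ← hl]
  have := Q.pow_d_apply (Q.circ i)
  rw [Q.orb_circ] at this
  rw [this]

/-- If the maximal heights of two adjacent orbits are as far apart as possible, the higher one is
read first. -/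
theorem IsAdapted.mem_prefix_or_notMem {A B : List V} {i j : Q.Index}
    (hL : Q.IsAdapted (A ++ Q.circ i :: B)) (hij : Q.IndexAdj i j)
    (h : |Q.ht i - Q.ht j| = Q.m i j) :
    Q.circ j ∈ A ∧ Q.ht i = Q.ht j - Q.m i j ∨ Q.circ j ∉ A ∧ Q.ht i = Q.ht j + Q.m i j := by
  have hm : 0 < Q.m i j := by
    have h1 := Q.d_pos i
    have h2 := Q.d_pos j
    unfold m; omega
  have hp := hL.ht_le
  rw [List.pairwise_append, List.pairwise_cons] at hp
  obtain ⟨-, ⟨hB, -⟩, hA⟩ := hp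
  have hji := hij.symm
  by_cases hjA : Q.circ j ∈ A
  · left
    have := hA _ hjA (Q.circ i) (by simp)
    rw [Q.orb_circ, Q.orb_circ, Q.m_comm j i] at this
    have := this hji
    rcases eq_or_eq_neg_of_abs_eq h with h | h
    · omega
    · exact ⟨hjA, by omega⟩
  · right
    have hjB : Q.circ j ∈ B := by
      have := (hL.mem_iff _).2 (Q.circ_mem j)
      rw [List.mem_append, List.mem_cons] at this
      rcases this with h | h | h
      · exact absurd h hjA
      · obtain ⟨v, w, h1, h2, h3⟩ := hij
        have := Q.circ_injective h
        exact absurd (by rw [h1, h2, this]) (Q.orb_ne_of_adj h3)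
      · exact h
    have := hB _ hjB
    rw [Q.orb_circ, Q.orb_circ] at this
    have := this hij
    rcases eq_or_eq_neg_of_abs_eq h with h | h
    · exact ⟨hjA, by omega⟩
    · omega

open Classical in
/-- The mesh relation at the vertex `i°`. It is the relation `ϖ + s ϖ = ∑ ϖ'` over the neighbours of
`i°`, transported by the reflections read before `i°`. -/
theorem IsAdapted.mesh_circ (hL : Q.IsAdapted L) (i : Q.Index) :
    Q.weight (Q.coxeter L) i (Q.ht i) + Q.weight (Q.coxeter L) i (Q.ht i - 2 * Q.d i) =
      ∑ j with Q.IndexAdj i j, ∑ t ∈ range (Q.mult i j),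
        Q.weight (Q.coxeter L) j (Q.ht i - Q.m i j - 2 * t) := by
  obtain ⟨A, B, hAB⟩ := List.mem_iff_append.1 ((hL.mem_iff _).2 (Q.circ_mem i))
  have hnd := hL.nodup
  have hw := hL.weight_of_lt
  have hwd := hL.weight_d
  have hLA := hL
  rw [hAB] at hLA
  have hnd' := hLA.nodup
  have hcA : Q.circ i ∉ A := fun h =>
    List.disjoint_of_nodup_append hnd' h List.mem_cons_self
  have hcB : Q.circ i ∉ B := (List.nodup_cons.1 (List.nodup_append.1 hnd').2.1).1
  -- the weight of a neighbour `w` after the reflections in `A`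
  have hval1 : ∀ w, w ∉ A → (A.map Q.simpleReflection).prod (Q.fundWeight w) = Q.fundWeight w :=
    fun w hw => Q.prod_simpleReflection_fundWeight hw
  have hval2 : ∀ j, Q.circ j ∈ A →
      (A.map Q.simpleReflection).prod (Q.fundWeight (Q.circ j)) =
        Q.weight (Q.coxeter L) j (Q.ht j - 2 * Q.d j) := fun j hj => by
    rw [hwd, Q.prefix_fundWeight hnd' hj, ← hAB]
  have hpow : ∀ j, ∀ k, 0 < k → k < Q.d j → (Q.σ ^ k) (Q.circ j) ∉ A := fun j k h0 hk h =>
    hL.pow_circ_notMem j h0 hk (by rw [hAB]; exact List.mem_append_left _ h)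
  rw [hwd, Q.weight_ht]
  have h1 : (L.map Q.simpleReflection).prod (Q.fundWeight (Q.circ i)) =
      -Q.fundWeight (Q.circ i) + ∑ w with Q.graph.Adj (Q.circ i) w,
        (A.map Q.simpleReflection).prod (Q.fundWeight w) := by
    rw [hAB, List.map_append, List.map_cons, List.prod_append, List.prod_cons,
      LinearEquiv.mul_apply, LinearEquiv.mul_apply, Q.prod_simpleReflection_fundWeight hcB,
      Q.simpleReflection_fundWeight_self, map_add, map_neg, hval1 _ hcA, map_sum]
  rw [h1, add_neg_cancel_left]
  by_cases hfix : Q.σ (Q.circ i) = Q.circ i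
  -- the neighbours of a fixed vertex form whole orbits
  · have hd : Q.d i = 1 := by
      have := Q.d_of_fixed hfix
      rwa [Q.orb_circ] at this
    rw [Q.sum_adj_of_fixed hfix Q.circ Q.orb_circ, Q.orb_circ]
    refine Finset.sum_congr rfl fun j hj => ?_
    simp only [Finset.mem_filter_univ] at hj
    have hadj : ∃ w, Q.orb w = j ∧ Q.graph.Adj (Q.circ i) w :=
      Q.exists_adj_of_indexAdj (by rwa [Q.orb_circ])
    obtain ⟨w, rfl, hcw⟩ := hadj
    have hm : Q.m i (Q.orb w) = 1 := by
      have := Q.m_of_fixed (w := w) (Or.inl hfix)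
      rwa [Q.orb_circ] at this
    have habs := Q.abs_ht_sub_of_fixed hcw (Or.inl hfix)
    rw [Q.orb_circ] at habs
    have hmult : Q.mult i (Q.orb w) = Q.d (Q.orb w) := by simp [mult, hd]
    rw [hmult, hm]
    obtain ⟨e, he⟩ : ∃ e, Q.d (Q.orb w) = e + 1 :=
      ⟨Q.d (Q.orb w) - 1, by have := Q.d_pos (Q.orb w); omega⟩
    rcases hLA.mem_prefix_or_notMem hj (by rw [habs, hm]) with ⟨hA, hht⟩ | ⟨hA, hht⟩
    · rw [hm] at hht
      rw [he, Finset.sum_range_succ', Finset.sum_range_succ]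
      congr 1
      · refine Finset.sum_congr rfl fun t ht => ?_
        have ht : t < e := by simpa using ht
        rw [hval1 _ (hpow _ _ (Nat.succ_pos t) (by omega)), ← hw _ (by omega), hht]
        congr 1
        push_cast; ring
      · rw [pow_zero, Equiv.Perm.one_apply, hval2 _ hA, he, hht]
        congr 1
        push_cast; ring
    · rw [hm] at hht
      refine Finset.sum_congr rfl fun t ht => ?_
      have ht : t < Q.d (Q.orb w) := by simpa using ht
      have : (Q.σ ^ t) (Q.circ (Q.orb w)) ∉ A := by
        rcases Nat.eq_zero_or_pos t with rfl | h0
        · exact hA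
        · exact hpow _ _ h0 ht
      rw [hval1 _ this, ← hw _ ht, hht]
      congr 1
      ring
  -- a non-fixed vertex has one neighbour `w` in each adjacent orbit, not necessarily the highest
  · have hd : Q.d i = Q.r := by
      have := Q.d_of_not_fixed hfix
      rwa [Q.orb_circ] at this
    have hr := Q.one_lt_r hfix
    have hmult : ∀ j, Q.mult i j = 1 := fun j => by
      rw [mult, if_neg (by omega)]
    have hm : ∀ j, Q.m i j = Q.d j := fun j => by
      have := Q.d_le_r j
      rw [m, hd]; omega
    have h2 := Q.sum_adj_of_not_fixed hfix
      (fun j => Q.weight (Q.coxeter L) j (Q.ht i - Q.d j))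
    rw [Q.orb_circ] at h2
    simp only [hmult, Finset.sum_range_one, hm, Nat.cast_zero, mul_zero, sub_zero]
    rw [← h2]
    refine Finset.sum_congr rfl fun w hcw => ?_
    simp only [Finset.mem_filter_univ] at hcw
    have hij : Q.IndexAdj i (Q.orb w) := ⟨Q.circ i, w, Q.orb_circ i, rfl, hcw⟩
    by_cases hwc : w = Q.circ (Q.orb w)
    · have habs : |Q.ht i - Q.ht (Q.orb w)| = Q.m i (Q.orb w) := by
        by_cases hwf : Q.σ w = w
        · have h3 := Q.abs_ht_sub_of_fixed hcw (Or.inr hwf)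
          rw [Q.orb_circ] at h3
          rw [hm, Q.d_of_fixed hwf, h3]; rfl
        · have h3 := Q.abs_ht_sub_of_adj_circ hfix hwf (by rwa [Q.orb_circ, ← hwc])
          rw [Q.orb_circ] at h3
          rw [hm, Q.d_of_not_fixed hwf, h3]
      rcases hLA.mem_prefix_or_notMem hij habs with ⟨hA, hht⟩ | ⟨hA, hht⟩
      · rw [hm] at hht
        have := hval2 _ hA
        rw [← hwc] at this
        rw [this, hht]
        congr 1
        ring
      · rw [hm] at hht
        have := Q.weight_ht (Q.coxeter L) (Q.orb w)
        rw [← hwc] at this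
        rw [hval1 _ (by rwa [hwc]), ← this, hht]
        congr 1
        ring
    · have hwf : Q.σ w ≠ w := fun h => hwc (Q.circ_of_fixed h).symm
      obtain ⟨l, hl, hwl⟩ := Q.exists_pow_lt_d (Q.orb_circ (Q.orb w)).symm
      rw [Q.orb_circ] at hl
      have hl0 : 0 < l := Nat.pos_of_ne_zero (by rintro rfl; exact hwc hwl)
      have hnadj : ¬ Q.graph.Adj (Q.circ i) (Q.circ (Q.orb w)) := fun h =>
        hwc (Q.eq_of_adj_of_orb_eq hfix h hcw (Q.orb_circ _).symm)
      have h3 := Q.abs_ht_sub_of_not_adj hcw hfix hwf (by rwa [Q.orb_circ])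
      have h4 := Q.height_of_not_fixed hfix hwf hcw
      have h5 := Q.two_mul_d_dvd_height_pow (Q.circ (Q.orb w)) l
      rw [← hwl, Q.orb_circ, Q.d_of_not_fixed hwf] at h5
      rw [Q.orb_circ] at h3
      rw [Q.d_of_not_fixed hwf] at hl ⊢
      have hwA : w ∉ A := by
        rw [hwl]; exact hpow _ _ hl0 (by rwa [Q.d_of_not_fixed hwf])
      -- the two heights agree modulo `2 r` and differ by less than `2 r`
      have key : Q.ht i - Q.r = Q.ht (Q.orb w) - 2 * l := by
        obtain ⟨a, ha⟩ := h5
        have hc : Q.ξ (Q.circ i) = Q.ht i := rfl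
        have hc' : Q.ξ (Q.circ (Q.orb w)) = Q.ht (Q.orb w) := rfl
        have h6 := abs_le.1 h3
        rw [hc] at h4
        rw [hc'] at ha
        have h7 : (2 * Q.r : ℤ) ∣ Q.ht i - Q.r - (Q.ht (Q.orb w) - 2 * l) := by
          rcases eq_or_eq_neg_of_abs_eq h4 with h | h
          · exact ⟨a, by linarith⟩
          · exact ⟨a - 1, by linarith⟩
        have h8 := Int.eq_zero_of_abs_lt_dvd h7 (by rw [abs_lt]; constructor <;> omega)
        linarith
      rw [hval1 _ hwA, key, hw _ (by rwa [Q.d_of_not_fixed hwf]), ← hwl]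

open Classical in
theorem IsAdapted.mesh (hL : Q.IsAdapted L) (i : Q.Index) (p : ℤ) :
    Q.weight (Q.coxeter L) i p + Q.weight (Q.coxeter L) i (p - 2 * Q.d i) =
      ∑ j with Q.IndexAdj i j, ∑ t ∈ range (Q.mult i j),
        Q.weight (Q.coxeter L) j (p - Q.m i j - 2 * t) := by
  by_cases h : (2 : ℤ) ∣ Q.ht i - p
  · obtain ⟨n, hn⟩ := h
    obtain rfl : p = Q.ht i - 2 * n := by omega
    have := congrArg (Q.coxeter L ^ n) (hL.mesh_circ i)
    simp only [map_add, map_sum, ← weight_sub_two_mul] at this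
    rw [show Q.ht i - 2 * n - 2 * (Q.d i : ℤ) = Q.ht i - 2 * (Q.d i : ℤ) - 2 * n by ring, this]
    refine Finset.sum_congr rfl fun j _ => Finset.sum_congr rfl fun t _ => ?_
    congr 1
    ring
  · rw [weight, if_neg h, weight, if_neg (by omega), add_zero]
    refine (Finset.sum_eq_zero fun j hj => Finset.sum_eq_zero fun t _ => ?_).symm
    simp only [Finset.mem_filter_univ] at hj
    obtain ⟨v, w, rfl, rfl, hvw⟩ := hj
    have := Q.two_dvd_ht_sub_sub_m hvw
    rw [weight, if_neg (by omega)]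

end QDatum

/-! ### The reading that carries each fundamental weight to its own height -/

namespace QDatum

variable {V : Type*} [Fintype V] (Q : QDatum V)

theorem mem_primeSet_iff (hr : Q.r = 2) (u : V) (p : ℤ) :
    (u, p) ∈ Q.primeSet ↔ u = Q.σ (Q.circ (Q.orb u)) ∧ Q.ξ u < p ∧ p ≤ Q.ht (Q.orb u) - 2 ∧
      (4 : ℤ) ∣ p - Q.ξ u := by
  have hd : Q.ξ u < p → p ≤ Q.ht (Q.orb u) - 2 → Q.d (Q.orb u) = 2 := fun h1 h2 => by
    by_cases hu : Q.σ u = u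
    · have := Q.ht_of_fixed hu
      omega
    · rw [Q.d_of_not_fixed hu, hr]
  constructor
  · rintro ⟨h1, v, hv, h2, h3, h4⟩
    simp only [repVertices, Set.mem_ofPred_eq, dv] at h1 h2 h3 h4
    rw [mem_circVertices_iff] at hv
    have h5 : Q.orb u = Q.orb v := by rw [h2, Q.orb_map]
    have h6 : Q.ht (Q.orb u) = Q.ξ v := by rw [h5, ht, ← hv]
    rw [← h2] at h3
    rw [← h6] at h4
    refine ⟨by rw [h5, ← hv, h2], h3, h4, ?_⟩
    rw [hd h3 h4] at h1
    exact h1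
  · rintro ⟨h1, h2, h3, h4⟩
    refine ⟨?_, Q.circ (Q.orb u), Q.circ_mem _, h1, ?_, h3⟩
    · simp only [repVertices, Set.mem_ofPred_eq, dv]
      rw [hd h2 h3]
      exact h4
    · rw [← h1]; exact h2

/-- An orbit occurring in `X'` is adjacent only to orbits of size `2`, and the edges between them
join `i°` to `j°`. -/
theorem adj_of_mem_primeSet (hr : Q.r = 2) {u w : V} {p : ℤ} (hu : (u, p) ∈ Q.primeSet)
    (h : Q.graph.Adj u w) : Q.σ u ≠ u ∧ Q.σ w ≠ w ∧ w = Q.σ (Q.circ (Q.orb w)) ∧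
      |Q.ξ u - Q.ξ w| = 2 ∧ |Q.ht (Q.orb u) - Q.ht (Q.orb w)| = 2 := by
  rw [Q.mem_primeSet_iff hr] at hu
  obtain ⟨h1, h2, h3, h4⟩ := hu
  have huf : Q.σ u ≠ u := fun hf => by
    have := Q.ht_of_fixed hf
    omega
  have hwf : Q.σ w ≠ w := fun hf => by
    have := (Q.ht_of_fixed_adj hf huf h.symm).2 1 (by omega)
    rw [pow_one, ← h1] at this
    push_cast at this
    omega
  have h5 := Q.height_of_not_fixed huf hwf h
  have h6 := Q.abs_ht_sub_le h
  rw [Q.m_of_not_fixed huf hwf, hr] at h6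
  rw [hr] at h5
  push_cast at h5 h6
  have h7 : w = Q.σ (Q.circ (Q.orb w)) := by
    obtain ⟨k, hk, e⟩ := Q.exists_pow_lt_r (Q.orb_circ (Q.orb w)).symm
    obtain rfl | rfl : k = 0 ∨ k = 1 := by omega
    · have e' : Q.ξ w = Q.ht (Q.orb w) := by
        conv_lhs => rw [e]
        rfl
      have := abs_le.1 h6
      have := abs_le.1 h5.le
      omega
    · exact e
  refine ⟨huf, hwf, h7, h5, ?_⟩
  rw [h1, h7, Q.adj_map] at h
  rw [Q.abs_ht_sub_of_adj_circ huf hwf h, hr]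
  rfl

theorem mem_primeSet_of_adj (hr : Q.r = 2) {u w : V} {p : ℤ} (hu : (u, p) ∈ Q.primeSet)
    (h : Q.graph.Adj u w) (hp : Q.ξ w < p - 2) : (w, p - 2) ∈ Q.primeSet := by
  obtain ⟨-, -, h3, h4, h5⟩ := Q.adj_of_mem_primeSet hr hu h
  rw [Q.mem_primeSet_iff hr] at hu ⊢
  obtain ⟨-, h2, h6, h7⟩ := hu
  refine ⟨h3, hp, ?_, ?_⟩
  · have := abs_le.1 h5.le
    omega
  · rcases eq_or_eq_neg_of_abs_eq h4 with h | h <;> omega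

theorem exists_adj {u : V} (hu : Q.σ u ≠ u) : ∃ w, Q.graph.Adj u w := by
  by_contra! hc
  obtain ⟨b, hb⟩ := Q.exists_fixed
  have := Q.forall_of_adj_closed (S := fun v => v = u)
    (fun v w hv hvw => absurd (hv ▸ hvw) (hc w)) rfl b
  exact hu (this ▸ hb)

section Order

variable {Q} [DecidableEq V] {l : List (V × ℤ)}

omit [Fintype V] in
theorem IsCompatibleReading.idxOf_lt {X : Set (V × ℤ)} (h : Q.IsCompatibleReading X l)
    {x y : V × ℤ} (hx : x ∈ X) (hy : y ∈ X) (hxy : Q.RepArrow y x) : l.idxOf x < l.idxOf y := by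
  have hx' := List.idxOf_lt_length_of_mem ((h.2.1 x).2 hx)
  have hy' := List.idxOf_lt_length_of_mem ((h.2.1 y).2 hy)
  have := h.2.2 ⟨_, hx'⟩ ⟨_, hy'⟩ (by simpa [List.get_eq_getElem, List.getElem_idxOf] using hxy)
  exact this

omit [DecidableEq V] in
theorem repArrow_of_mem_primeSet (hr : Q.r = 2) {u w : V} {p : ℤ} (hu : (u, p) ∈ Q.primeSet)
    (hw : (w, p - 2) ∈ Q.primeSet) (h : Q.graph.Adj u w) : Q.RepArrow (w, p - 2) (u, p) := by
  obtain ⟨h1, h2, -⟩ := Q.adj_of_mem_primeSet hr hu h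
  refine ⟨hw.1, hu.1, h.symm, ?_⟩
  simp only [dv]
  rw [Q.d_of_not_fixed h1, Q.d_of_not_fixed h2, hr]
  push_cast
  omega

theorem IsCompatibleReading.idxOf_lt_of_adj (hr : Q.r = 2)
    (hl : Q.IsCompatibleReading Q.primeSet l) {u w : V} (h : Q.graph.Adj u w) (n : ℕ) :
    ∀ a, (u, a) ∈ Q.primeSet → (w, a - 2 - 4 * n) ∈ Q.primeSet →
      l.idxOf (u, a) < l.idxOf (w, a - 2 - 4 * (n : ℤ)) := by
  induction n with
  | zero =>
    intro a hu hw
    simp only [Nat.cast_zero, mul_zero, sub_zero] at hw ⊢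
    exact hl.idxOf_lt hu hw (repArrow_of_mem_primeSet hr hu hw h)
  | succ n ih =>
    intro a hu hw
    have h1 := (Q.mem_primeSet_iff hr _ _).1 hw
    have h2 := abs_le.1 (Q.adj_of_mem_primeSet hr hu h).2.2.2.1.le
    have h4 := h1.2.2.2
    have h3 := h1.2.1
    push_cast at h3 h4
    have m1 := Q.mem_primeSet_of_adj hr hu h (by omega)
    have m2 := Q.mem_primeSet_of_adj hr m1 h.symm (by omega)
    have e1 := hl.idxOf_lt hu m1 (repArrow_of_mem_primeSet hr hu m1 h)
    have e2 := hl.idxOf_lt m1 m2 (repArrow_of_mem_primeSet hr m1 m2 h.symm)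
    have e : a - 2 - 4 * ((n + 1 : ℕ) : ℤ) = a - 2 - 2 - 2 - 4 * (n : ℤ) := by push_cast; ring
    rw [e] at hw ⊢
    exact e1.trans (e2.trans (ih _ m2 hw))

/-- In a compatible reading of `X'`, the elements over an edge or a vertex are read downwards,
although arrows only compare elements at minimal distance. -/
theorem IsCompatibleReading.idxOf_lt_of_lt (hr : Q.r = 2)
    (hl : Q.IsCompatibleReading Q.primeSet l) {u w : V} {a b : ℤ} (hu : (u, a) ∈ Q.primeSet)
    (hw : (w, b) ∈ Q.primeSet) (hba : b < a) (h : Q.graph.Adj u w ∨ w = u) :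
    l.idxOf (u, a) < l.idxOf (w, b) := by
  have adj : ∀ {u w : V} {a b : ℤ}, (u, a) ∈ Q.primeSet → (w, b) ∈ Q.primeSet → b < a →
      Q.graph.Adj u w → l.idxOf (u, a) < l.idxOf (w, b) := by
    intro u w a b hu hw hba h
    have h1 := ((Q.mem_primeSet_iff hr _ _).1 hw).2.2.2
    have h2 := ((Q.mem_primeSet_iff hr _ _).1 hu).2.2.2
    have h3 := (Q.adj_of_mem_primeSet hr hu h).2.2.2.1
    obtain ⟨n, hn⟩ : ∃ n : ℕ, b = a - 2 - 4 * n := by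
      refine ⟨((a - 2 - b) / 4).toNat, ?_⟩
      rcases eq_or_eq_neg_of_abs_eq h3 with h | h <;> omega
    rw [hn] at hw ⊢
    exact hl.idxOf_lt_of_adj hr h n a hu hw
  rcases h with h | rfl
  · exact adj hu hw hba h
  · have h1 := (Q.mem_primeSet_iff hr _ _).1 hu
    have h2 := (Q.mem_primeSet_iff hr _ _).1 hw
    have hwf : Q.σ w ≠ w := fun hf => by
      have := Q.ht_of_fixed hf
      omega
    obtain ⟨z, hz⟩ := Q.exists_adj hwf
    have h3 := abs_le.1 (Q.adj_of_mem_primeSet hr hu hz).2.2.2.1.le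
    have m1 := Q.mem_primeSet_of_adj hr hu hz (by omega)
    exact (adj hu m1 (by omega) hz).trans (adj m1 hw (by omega) hz.symm)

/-- The vertex `v` stands at the height `q` after the elements of `y` have been read: `q` is the
smallest height reached by the elements of `X'` over `v` which occur in `y`. -/
structure IsLevel (Q : QDatum V) (y : List (V × ℤ)) (v : V) (q : ℤ) : Prop where
  le : Q.ξ v ≤ q
  le_ht : q ≤ Q.ht (Q.orb v) - 2
  dvd : (4 : ℤ) ∣ q - Q.ξ v
  mem : ∀ p, (v, p) ∈ Q.primeSet → q < p → (v, p) ∈ y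
  notMem : ∀ p, (v, p) ∈ Q.primeSet → p ≤ q → (v, p) ∉ y

omit [DecidableEq V] in
theorem IsLevel.of_concat_of_ne {y : List (V × ℤ)} {x : V × ℤ} {v : V} {q : ℤ}
    (h : IsLevel Q (y ++ [x]) v q) (hv : v ≠ x.1) : IsLevel Q y v q where
  le := h.le
  le_ht := h.le_ht
  dvd := h.dvd
  mem p h1 h2 := by
    have := h.mem p h1 h2
    rw [List.mem_append, List.mem_singleton] at this
    exact this.resolve_right fun e => hv (by rw [← e])
  notMem p h1 h2 h3 := h.notMem p h1 h2 (List.mem_append_left _ h3)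

omit [Fintype V] in
theorem IsCompatibleReading.mem_prefix_iff {X : Set (V × ℤ)} {y z : List (V × ℤ)} {x a : V × ℤ}
    (hl : Q.IsCompatibleReading X (y ++ x :: z)) :
    a ∈ y ↔ (y ++ x :: z).idxOf a < (y ++ x :: z).idxOf x := by
  have hx : x ∉ y := fun h => List.disjoint_of_nodup_append hl.1 h List.mem_cons_self
  rw [List.idxOf_append_of_notMem hx, List.idxOf_cons_self, add_zero]
  constructor
  · intro h
    rw [List.idxOf_append_of_mem h]
    exact List.idxOf_lt_length_of_mem h
  · intro h
    by_contra hn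
    rw [List.idxOf_append_of_notMem hn] at h
    omega

/-- The level at `x = (u, p)` drops from `p` to `p - 4` when `x` is read. -/
theorem IsLevel.of_concat_self (hr : Q.r = 2) {y z : List (V × ℤ)} {u : V} {p q : ℤ}
    (hl : Q.IsCompatibleReading Q.primeSet (y ++ (u, p) :: z))
    (h : IsLevel Q (y ++ [(u, p)]) u q) : q = p - 4 ∧ IsLevel Q y u p := by
  have hx : (u, p) ∈ Q.primeSet := (hl.2.1 _).1 (by simp)
  obtain ⟨h1, h2, h3, h4⟩ := (Q.mem_primeSet_iff hr _ _).1 hx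
  have hxy : (u, p) ∉ y := fun h => List.disjoint_of_nodup_append hl.1 h List.mem_cons_self
  have hqp : q < p := by
    by_contra hc
    exact h.notMem p hx (not_lt.1 hc) (by simp)
  have hdvd := h.dvd
  have hle := h.le
  have hq : q = p - 4 := by
    by_contra hne
    have hm : (u, p - 4) ∈ Q.primeSet :=
      (Q.mem_primeSet_iff hr _ _).2 ⟨h1, by omega, by omega, by omega⟩
    have := h.mem _ hm (by omega)
    rw [List.mem_append, List.mem_singleton, Prod.mk.injEq] at this
    have := (hl.mem_prefix_iff).1 (this.resolve_right fun e => by omega)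
    have := hl.idxOf_lt_of_lt hr hx hm (by omega) (Or.inr rfl)
    omega
  refine ⟨hq, h2.le, h3, h4, fun p' hp' hlt => ?_, fun p' hp' hle' hmem => ?_⟩
  · have := h.mem p' hp' (by omega)
    rw [List.mem_append, List.mem_singleton, Prod.mk.injEq] at this
    exact this.resolve_right fun e => by omega
  · have h5 := ((Q.mem_primeSet_iff hr _ _).1 hp').2.2.2
    by_cases e : p' = p
    · exact hxy (e ▸ hmem)
    · exact h.notMem p' hp' (by omega) (List.mem_append_left _ hmem)

/-- When `(u, p)` is read, the neighbours of `u` stand at the height `p - 2`. -/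
theorem isLevel_of_adj (hr : Q.r = 2) {y z : List (V × ℤ)} {u w : V} {p : ℤ}
    (hl : Q.IsCompatibleReading Q.primeSet (y ++ (u, p) :: z)) (h : Q.graph.Adj u w) :
    IsLevel Q y w (p - 2) := by
  have hx : (u, p) ∈ Q.primeSet := (hl.2.1 _).1 (by simp)
  obtain ⟨-, -, h1, h2, h3⟩ := Q.adj_of_mem_primeSet hr hx h
  obtain ⟨-, h5, h6, h7⟩ := (Q.mem_primeSet_iff hr _ _).1 hx
  have h2' := abs_le.1 h2.le
  have h3' := abs_le.1 h3.le
  have h8 : (4 : ℤ) ∣ p - 2 - Q.ξ w := by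
    rcases eq_or_eq_neg_of_abs_eq h2 with h | h <;> omega
  refine ⟨by omega, by omega, h8, fun p' hp' hlt => ?_, fun p' hp' hle hmem => ?_⟩
  · have h9 := ((Q.mem_primeSet_iff hr _ _).1 hp').2.2.2
    exact hl.mem_prefix_iff.2 (hl.idxOf_lt_of_lt hr hp' hx (by omega) (Or.inl h.symm))
  · have := hl.mem_prefix_iff.1 hmem
    have := hl.idxOf_lt_of_lt hr hx hp' (by omega) (Or.inl h)
    omega

variable {L : List V}

open Classical in
theorem IsAdapted.prefix_weight_of_isLevel (hL : Q.IsAdapted L) (hr : Q.r = 2)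
    (y : List (V × ℤ)) : ∀ z, Q.IsCompatibleReading Q.primeSet (y ++ z) → ∀ v q,
      v = Q.σ (Q.circ (Q.orb v)) → IsLevel Q y v q →
      (y.map fun x => Q.simpleReflection x.1).prod (Q.fundWeight v) =
        Q.weight (Q.coxeter L) (Q.orb v) q := by
  induction y using List.reverseRecOn with
  | nil =>
    intro z hl v q hv hq
    have hvf : Q.σ v ≠ v := fun hf => by
      have h1 := Q.ht_of_fixed hf
      have h2 := hq.le
      have h3 := hq.le_ht
      omega
    have hd : Q.d (Q.orb v) = 2 := by rw [Q.d_of_not_fixed hvf, hr]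
    have h1 := hq.le
    have h2 := hq.le_ht
    have h3 := hq.dvd
    have h4 := Q.two_mul_d_dvd_height_map (Q.circ (Q.orb v))
    rw [← hv, Q.orb_circ, hd] at h4
    change _ ∣ Q.ξ v - Q.ht (Q.orb v) + 2 at h4
    push_cast at h4
    have hq' : q = Q.ht (Q.orb v) - 2 * (1 : ℕ) := by
      by_contra hne
      push_cast at hne
      have hm : (v, q + 4) ∈ Q.primeSet :=
        (Q.mem_primeSet_iff hr _ _).2 ⟨hv, by omega, by omega, by omega⟩
      exact absurd (hq.mem _ hm (by omega)) (by simp)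
    rw [hq', hL.weight_of_lt _ (by omega), pow_one, ← hv]
    rfl
  | append_singleton y x ih =>
    obtain ⟨u, p⟩ := x
    intro z hl v q hv hq
    rw [List.append_assoc, List.singleton_append] at hl
    have ih := ih _ hl
    rw [List.map_append, List.prod_append, LinearEquiv.mul_apply, List.map_singleton,
      List.prod_singleton]
    by_cases hvu : v = u
    · subst hvu
      obtain ⟨rfl, hp⟩ := hq.of_concat_self hr hl
      have hx : (v, p) ∈ Q.primeSet := (hl.2.1 _).1 (by simp)
      have hvf : Q.σ v ≠ v := fun hf => by
        have h1 := Q.ht_of_fixed hf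
        have h2 := hp.le
        have h3 := hp.le_ht
        omega
      have hd : Q.d (Q.orb v) = 2 := by rw [Q.d_of_not_fixed hvf, hr]
      have hnb : ∀ w ∈ Finset.univ.filter (Q.graph.Adj v),
          (y.map fun x => Q.simpleReflection x.1).prod (Q.fundWeight w) =
            Q.weight (Q.coxeter L) (Q.orb w) (p - Q.m (Q.orb v) (Q.orb w) - 2 * (0 : ℕ)) := by
        intro w hw
        simp only [Finset.mem_filter_univ] at hw
        obtain ⟨-, h1, h2, -⟩ := Q.adj_of_mem_primeSet hr hx hw
        rw [ih w (p - 2) h2 (isLevel_of_adj hr hl hw), Q.m_of_not_fixed hvf h1, hr]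
        simp
      have hmult : ∀ j, Q.mult (Q.orb v) j = 1 := fun j => by simp [mult, hd]
      have hmesh := hL.mesh (Q.orb v) p
      simp only [hmult, Finset.sum_range_one] at hmesh
      rw [Q.simpleReflection_fundWeight_self, map_add, map_neg, map_sum, ih v p hv hp,
        Finset.sum_congr rfl hnb, Q.sum_adj_of_not_fixed hvf (fun j =>
          Q.weight (Q.coxeter L) j (p - Q.m (Q.orb v) j - 2 * (0 : ℕ))), ← hmesh,
        neg_add_cancel_left, hd]
      rfl
    · rw [Q.simpleReflection_fundWeight_of_ne hvu]
      exact ih v q hv (hq.of_concat_of_ne hvu)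

/-- Reading `X'` moves every vertex `v` from its height in the regular position, where
`σ ^ l i°` has height `ξ_{i°} - 2 l`, to the height `ξ_v`. -/
theorem IsAdapted.weight_height (hL : Q.IsAdapted L)
    (hl : Q.IsCompatibleReading Q.primeSet l) (v : V) :
    (l.map fun x => Q.simpleReflection x.1).prod (Q.fundWeight v) =
      Q.weight (Q.coxeter L) (Q.orb v) (Q.ξ v) := by
  obtain ⟨k, hk, hvk⟩ := Q.exists_pow_lt_d (Q.orb_circ (Q.orb v)).symm
  rw [Q.orb_circ] at hk
  -- orbits with regularly spaced heights do not occur in `X'`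
  have regular : Q.ξ v = Q.ht (Q.orb v) - 2 * k →
      Q.ht (Q.orb v) - 2 ≤ Q.ξ (Q.σ (Q.circ (Q.orb v))) →
      (l.map fun x => Q.simpleReflection x.1).prod (Q.fundWeight v) =
      Q.weight (Q.coxeter L) (Q.orb v) (Q.ξ v) := by
    intro h1 h2
    rw [h1, hL.weight_of_lt _ hk, ← hvk]
    have : (l.map fun x => Q.simpleReflection x.1) = (l.map Prod.fst).map Q.simpleReflection := by
      rw [List.map_map]; rfl
    rw [this, Q.prod_simpleReflection_fundWeight]
    rw [List.mem_map]
    rintro ⟨x, hx, rfl⟩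
    obtain ⟨-, u, hu, h3, h4, h5⟩ := (hl.2.1 x).1 hx
    rw [mem_circVertices_iff] at hu
    have : Q.orb x.1 = Q.orb u := by rw [h3, Q.orb_map]
    rw [this, ← hu, ht, ← hu] at h2
    omega
  by_cases hvf : Q.σ v = v
  · have hc := Q.circ_of_fixed hvf
    have hd := Q.d_of_fixed hvf
    have hht := Q.ht_of_fixed hvf
    refine regular ?_ ?_
    · have : k = 0 := by omega
      rw [this, hht]; simp
    · rw [hc, hvf, hht]; omega
  have hd := Q.d_of_not_fixed hvf
  rcases Q.r_cases with hr | hr | hr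
  · have := Q.one_lt_r hvf
    omega
  · by_cases hv : v = Q.circ (Q.orb v)
    · have hnot : v ∉ l.map Prod.fst := by
        rw [List.mem_map]
        rintro ⟨⟨v', p⟩, hx, rfl⟩
        obtain ⟨h1, -⟩ := (Q.mem_primeSet_iff hr _ _).1 ((hl.2.1 _).1 hx)
        simp only at hv h1 hvf
        rw [← hv] at h1
        exact hvf h1.symm
      have : (l.map fun x => Q.simpleReflection x.1) =
          (l.map Prod.fst).map Q.simpleReflection := by
        rw [List.map_map]; rfl
      rw [this, Q.prod_simpleReflection_fundWeight hnot]
      conv_lhs => rw [hv]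
      rw [← Q.weight_ht (Q.coxeter L), ht, ← hv]
    -- the level of `v` after the whole of `X'` is `ξ_v`
    · obtain rfl : k = 1 := by
        have : k ≠ 0 := by rintro rfl; exact hv hvk
        omega
      refine hL.prefix_weight_of_isLevel hr l [] (by simpa using hl) v _ hvk
        ⟨le_rfl, Q.height_le_ht_sub_two hv, by simp, fun p hp _ => (hl.2.1 _).2 hp,
          fun p hp hle => ?_⟩
      have := ((Q.mem_primeSet_iff hr _ _).1 hp).2.1
      omega
  · obtain ⟨u, hu, huv⟩ := Q.exists_fixed_adj_of_r_eq_three hr hvf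
    have := (Q.ht_of_fixed_adj hu hvf huv).2
    refine regular ?_ ?_
    · have := this k (by omega)
      rwa [← hvk] at this
    · have := this 1 (by omega)
      rw [pow_one] at this
      rw [this]; simp

end Order

end QDatum

/-! ### Invariance of the form, and pairings of orbit weights with roots -/

namespace FoldedDiagram

theorem cartan_transpose {V : Type*} (F : FoldedDiagram V) :
    ((simplyLacedCartan F.graph).map (Int.cast : ℤ → ℚ)).transpose =
    (simplyLacedCartan F.graph).map (Int.cast : ℤ → ℚ) := by
  ext v w
  simp [simplyLacedCartan_comm _ v w]

variable {V : Type*} [Fintype V] [DecidableEq V] (F : FoldedDiagram V)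

theorem form_add_right (x y z : V → ℤ) : F.form x (y + z) = F.form x y + F.form x z := by
  have : (fun v => (((y + z) v : ℤ) : ℚ)) = (fun v => (y v : ℚ)) + fun v => (z v : ℚ) := by
    ext v; simp
  rw [form, this, Matrix.mulVec_add, dotProduct_add]
  rfl

theorem form_smul_right (n : ℤ) (x y : V → ℤ) : F.form x (n • y) = n * F.form x y := by
  have : (fun v => (((n • y) v : ℤ) : ℚ)) = (n : ℚ) • fun v => (y v : ℚ) := by
    ext v; simp
  rw [form, this, Matrix.mulVec_smul, dotProduct_smul, smul_eq_mul]
  rfl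

theorem form_comm (x y : V → ℤ) : F.form x y = F.form y x := by
  rw [form, form, Matrix.dotProduct_mulVec, ← Matrix.mulVec_transpose, Matrix.transpose_nonsing_inv,
    cartan_transpose, dotProduct_comm]

theorem form_simpleRoot (x : V → ℤ) (v : V) : F.form x (F.simpleRoot v) = x v := by
  have h : (fun w => (F.simpleRoot v w : ℚ)) =
      ((simplyLacedCartan F.graph).map (Int.cast : ℤ → ℚ)).mulVec (Pi.single v 1) := by
    ext w
    simp [simpleRoot]
  have hdet := (isUnit_iff_ne_zero.2 F.det_cartan_ne_zero)
  rw [form, h, Matrix.mulVec_mulVec, Matrix.nonsing_inv_mul _ hdet, Matrix.one_mulVec,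
    dotProduct_single, mul_one]

/-- The group of isometries of the weight lattice. -/
def isometryGroup : Subgroup ((V → ℤ) ≃ₗ[ℤ] (V → ℤ)) where
  carrier := {g | ∀ x y, F.form (g x) (g y) = F.form x y}
  mul_mem' {g h} hg hh x y := by rw [LinearEquiv.mul_apply, LinearEquiv.mul_apply, hg, hh]
  one_mem' x y := rfl
  inv_mem' {g} hg x y := by
    rw [← hg, ← LinearEquiv.mul_apply, ← LinearEquiv.mul_apply, mul_inv_cancel]
    rfl

variable {F} in
theorem form_map_of_mem {g : (V → ℤ) ≃ₗ[ℤ] (V → ℤ)} (hg : g ∈ F.isometryGroup) (x y : V → ℤ) :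
    F.form (g x) (g y) = F.form x y := hg x y

theorem simpleReflection_mem (v : V) : F.simpleReflection v ∈ F.isometryGroup := by
  intro x y
  have h (x y : V → ℤ) : F.form x (y - y v • F.simpleRoot v) = F.form x y - y v * x v := by
    rw [sub_eq_add_neg, ← neg_smul, form_add_right, form_smul_right, form_simpleRoot]
    push_cast; ring
  have h2 : (F.simpleRoot v) v = 2 := F.simpleRoot_self v
  rw [simpleReflection_apply, simpleReflection_apply, h, form_comm, h, form_comm]
  simp only [Pi.sub_apply, Pi.smul_apply, h2, smul_eq_mul]
  push_cast; ring

theorem sigmaAut_mem : F.sigmaAut ∈ F.isometryGroup := by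
  intro x y
  have hx : ∀ x : V → ℤ, (fun v => ((F.sigmaAut x v : ℤ) : ℚ)) =
      (fun v => (x v : ℚ)) ∘ F.σ.symm := fun x => rfl
  have hA : ((simplyLacedCartan F.graph).map (Int.cast : ℤ → ℚ)).submatrix F.σ F.σ =
      (simplyLacedCartan F.graph).map (Int.cast : ℤ → ℚ) := by
    ext v w
    simp [F.cartan_map]
  have hinv := Matrix.inv_submatrix_equiv ((simplyLacedCartan F.graph).map (Int.cast : ℤ → ℚ))
    F.σ F.σ
  rw [hA] at hinv
  rw [form, form, hx, hx, ← comp_equiv_dotProduct_comp_equiv _ _ F.σ,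
    ← Matrix.submatrix_mulVec_equiv, ← hinv]
  congr 1
  ext v
  simp

theorem prod_simpleReflection_mem (l : List V) :
    (l.map F.simpleReflection).prod ∈ F.isometryGroup :=
  list_prod_mem fun g hg => by
    obtain ⟨v, -, rfl⟩ := List.mem_map.1 hg
    exact F.simpleReflection_mem v

end FoldedDiagram

namespace QDatum

/-- The root `(1 - τ ^ d) ϖ_c` of a vertex `c` is `g α_c`, with `g` the product of the reflections
read before `c`. -/
theorem root_eq {V : Type*} [DecidableEq V] {Q : QDatum V} {A B : List V} {c : V}
    (hnd : (A ++ c :: B).Nodup) :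
    Q.fundWeight c - ((A ++ c :: B).map Q.simpleReflection).prod (Q.fundWeight c) =
      (A.map Q.simpleReflection).prod (Q.simpleRoot c) := by
  have hcA : c ∉ A := fun h => List.disjoint_of_nodup_append hnd h List.mem_cons_self
  have hcB : c ∉ B := (List.nodup_cons.1 (List.nodup_append.1 hnd).2.1).1
  rw [List.map_append, List.map_cons, List.prod_append, List.prod_cons, LinearEquiv.mul_apply,
    LinearEquiv.mul_apply, Q.prod_simpleReflection_fundWeight hcB, Q.simpleReflection_apply,
    map_sub, Q.prod_simpleReflection_fundWeight hcA, sub_sub_cancel, map_smul]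
  simp [FoldedDiagram.fundWeight]

variable {V : Type*} [Fintype V] [DecidableEq V] {Q : QDatum V} {L : List V}

theorem coxeter_mem (Q : QDatum V) (L : List V) : Q.coxeter L ∈ Q.isometryGroup :=
  mul_mem (Q.prod_simpleReflection_mem L) Q.sigmaAut_mem

/-- The function `p ↦ (Φ, γ)` for the weight `Φ` of the orbit `i` at the height `p` and the
root `γ = g α_c`, where `g` is the product of the reflections at the vertices in `A`. As `g` is an
isometry, it is the coordinate of `g⁻¹ Φ` at `c`, an integer. -/
noncomputable def pairing (Q : QDatum V) (L A : List V) (c : V) (i : Q.Index) (p : ℤ) : ℤ :=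
  ((A.map Q.simpleReflection).prod⁻¹ (Q.weight (Q.coxeter L) i p)) c

theorem IsAdapted.form_weight {A B : List V} {k : Q.Index}
    (hL : Q.IsAdapted (A ++ Q.circ k :: B)) (x : V → ℤ) :
    Q.form x (Q.weight (Q.coxeter (A ++ Q.circ k :: B)) k (Q.ht k) -
      Q.weight (Q.coxeter (A ++ Q.circ k :: B)) k (Q.ht k - 2 * Q.d k)) =
      (((A.map Q.simpleReflection).prod⁻¹ x) (Q.circ k) : ℤ) := by
  rw [hL.weight_d, Q.weight_ht, root_eq hL.nodup, ← Q.form_simpleRoot,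
    ← FoldedDiagram.form_map_of_mem (inv_mem (Q.prod_simpleReflection_mem A)),
    ← LinearEquiv.mul_apply _ _ (Q.simpleRoot _), inv_mul_cancel]
  rfl

/-- The right-hand side of the formula, transported to the twisted Coxeter element of `L`. -/
theorem IsAdapted.form_eq_pairing {A B : List V} {k : Q.Index}
    (hL : Q.IsAdapted (A ++ Q.circ k :: B)) {l : List (V × ℤ)}
    (hl : Q.IsCompatibleReading Q.primeSet l) {w₁ τ : (V → ℤ) ≃ₗ[ℤ] (V → ℤ)}
    (hw₁ : w₁ = (l.map fun x => Q.simpleReflection x.1).prod)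
    (hτ : τ = w₁⁻¹ * Q.coxeter (A ++ Q.circ k :: B) * w₁) {v w : V} (hw : Q.orb w = k) (u : ℤ) :
    (if (2 : ℤ) ∣ u + Q.ξ w - Q.ξ v - Q.d (Q.orb v) then
      Q.form (Q.fundWeight v) ((τ ^ ((u + Q.ξ w - Q.ξ v - Q.d (Q.orb v)) / 2)) (Q.γ τ w)) else 0) =
    (Q.pairing (A ++ Q.circ k :: B) A (Q.circ k) (Q.orb v)
      (u + Q.ht k - Q.d (Q.orb v)) : ℚ) := by
  subst hw
  set L := A ++ Q.circ (Q.orb w) :: B with hLdef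
  have h1 : (2 : ℤ) ∣ Q.ξ w - Q.ht (Q.orb w) := Q.two_dvd_height_sub (by simp)
  have h2 : (2 : ℤ) ∣ Q.ξ v - Q.ht (Q.orb v) := Q.two_dvd_height_sub (by simp)
  split_ifs with h
  · obtain ⟨m, hm⟩ := h
    rw [hm, Int.mul_ediv_cancel_left _ two_ne_zero]
    have hw1 : ∀ z, w₁ (Q.fundWeight z) = Q.weight (Q.coxeter L) (Q.orb z) (Q.ξ z) := fun z => by
      rw [hw₁]; exact hL.weight_height hl z
    have hw1mem : w₁ ∈ Q.isometryGroup := by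
      have : (l.map fun x => Q.simpleReflection x.1) =
          (l.map Prod.fst).map Q.simpleReflection := by
        rw [List.map_map]; rfl
      rw [hw₁, this]
      exact Q.prod_simpleReflection_mem _
    have hpow : ∀ n : ℤ, w₁ * τ ^ n = Q.coxeter L ^ n * w₁ := fun n => by
      have : τ = w₁⁻¹ * Q.coxeter L * (w₁⁻¹)⁻¹ := by rw [inv_inv, hτ]
      rw [this, conj_zpow]
      group
    have hpow' : ∀ (n : ℤ) x, w₁ ((τ ^ n) x) = (Q.coxeter L ^ n) (w₁ x) := fun n x => by
      rw [← LinearEquiv.mul_apply, hpow, LinearEquiv.mul_apply]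
    have hγ : w₁ (Q.γ τ w) = Q.weight (Q.coxeter L) (Q.orb w) (Q.ξ w) -
        Q.weight (Q.coxeter L) (Q.orb w) (Q.ξ w - 2 * Q.d (Q.orb w)) := by
      rw [γ, map_sub, ← zpow_natCast, hpow', hw1, ← weight_sub_two_mul]
      rfl
    obtain ⟨n, hn⟩ := h1
    rw [← FoldedDiagram.form_map_of_mem hw1mem, hpow', hγ, hw1,
      ← FoldedDiagram.form_map_of_mem (zpow_mem (Q.coxeter_mem L) (n - m)),
      ← LinearEquiv.mul_apply _ (Q.coxeter L ^ m), ← zpow_add, sub_add_cancel, map_sub,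
      ← weight_sub_two_mul, ← weight_sub_two_mul, ← weight_sub_two_mul,
      show Q.ξ w - 2 * n = Q.ht (Q.orb w) by omega,
      show Q.ξ w - 2 * (Q.d (Q.orb w) : ℤ) - 2 * n =
        Q.ht (Q.orb w) - 2 * Q.d (Q.orb w) by omega,
      show Q.ξ v - 2 * (n - m) = u + Q.ht (Q.orb w) - Q.d (Q.orb v) by omega, hL.form_weight]
    rfl
  · rw [pairing, weight, if_neg (by omega)]
    simp

end QDatum

/-! ### Truncated solutions of the mesh relation -/

/-- The combinatorial form of the equation `C(z) f = 0`: a family of sequences `f i`, indexed so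
that the relation of `i` involves `f j` at `p - m i j - 2 t` for `t < n i j`. By `add_eq` the lowest
of these heights is `p + m i j - 2 d j`. -/
structure MeshSystem (I : Type*) where
  d : I → ℤ
  Adj : I → I → Prop
  m : I → I → ℤ
  n : I → I → ℕ
  m_pos : ∀ i j, Adj i j → 0 < m i j
  add_eq : ∀ i j, Adj i j → m i j + n i j = d j + 1
  d_pos : ∀ i, 0 < d i

namespace MeshSystem

variable {I : Type*} [Fintype I] (S : MeshSystem I)

open Classical in
/-- The defect of `f` in the relation of `i` at the height `p`. -/
noncomputable def mesh (f : I → ℤ → ℤ) (i : I) (p : ℤ) : ℤ :=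
  f i p + f i (p - 2 * S.d i) -
    ∑ j with S.Adj i j, ∑ t ∈ range (S.n i j), f j (p - S.m i j - 2 * t)

theorem mesh_congr {f g : I → ℤ → ℤ} {i : I} {p : ℤ} (h1 : f i p = g i p)
    (h2 : f i (p - 2 * S.d i) = g i (p - 2 * S.d i))
    (h3 : ∀ j, S.Adj i j → ∀ t < S.n i j, f j (p - S.m i j - 2 * t) = g j (p - S.m i j - 2 * t)) :
    S.mesh f i p = S.mesh g i p := by
  classical
  rw [mesh, mesh, h1, h2]
  congr 1
  refine Finset.sum_congr rfl fun j hj => Finset.sum_congr rfl fun t ht => ?_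
  exact h3 j (by simpa using hj) t (by simpa using ht)

theorem mesh_sub (f g : I → ℤ → ℤ) (i : I) (p : ℤ) :
    S.mesh (fun i p => f i p - g i p) i p = S.mesh f i p - S.mesh g i p := by
  simp only [mesh, Finset.sum_sub_distrib]
  ring

/-- The mesh relation determines a system with vanishing terms at large heights downwards. -/
theorem eq_zero_of_mesh {f : I → ℤ → ℤ} {N P : ℤ} (hN : ∀ i p, N ≤ p → f i p = 0)
    (h : ∀ i p, P < p → S.mesh f i p = 0) (i : I) {p : ℤ} (hp : P < p) :
    f i (p - 2 * S.d i) = 0 := by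
  obtain ⟨D, hD⟩ : ∃ D, ∀ i, S.d i ≤ D := by
    obtain ⟨D, hD⟩ := (Set.finite_range S.d).bddAbove
    exact ⟨D, fun i => hD ⟨i, rfl⟩⟩
  obtain ⟨a, ha⟩ : ∃ a : ℕ, N + 2 * D - p ≤ a := ⟨(N + 2 * D - p).toNat, by omega⟩
  induction a using Nat.strong_induction_on generalizing i p with
  | _ a ih =>
    have main : ∀ j q, p - 2 * S.d j < q → f j q = 0 := by
      intro j q hq
      by_cases hNq : N ≤ q
      · exact hN j q hNq
      · have hdj := S.d_pos j
        have := hD j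
        have := ih (a - 1) (by omega) j (p := q + 2 * S.d j) (by omega) (by omega)
        rwa [add_sub_cancel_right] at this
    have hdi := S.d_pos i
    have h1 : S.mesh f i p = f i (p - 2 * S.d i) := by
      classical
      rw [mesh, main i p (by omega), zero_add, sub_eq_self]
      refine Finset.sum_eq_zero fun j hj => Finset.sum_eq_zero fun t ht => main _ _ ?_
      have hj : S.Adj i j := by simpa using hj
      have ht : t < S.n i j := by simpa using ht
      have e1 := S.add_eq i j hj
      have e2 := S.m_pos i j hj
      omega
    rw [← h1]
    exact h i p hp

variable {S} in
/-- The truncation of a solution `f` of the mesh relation along a slice `L` is a fundamental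
solution, provided that on the slice `f` is the delta function at `k`. The part of `f` cut off
vanishes at all heights above `L k - 2 d i`. -/
theorem truncation [DecidableEq I] {f : I → ℤ → ℤ} {L : I → ℤ} {k : I}
    (hf : ∀ i p, S.mesh f i p = 0)
    (hwin : ∀ j q, L j - 2 * S.d j < q → q < L j → f j q = 0)
    (htop : ∀ j, f j (L j) = if j = k then 1 else 0)
    (hL : ∀ i j, S.Adj i j → |L i - L j| ≤ S.m i j)
    (hk : ∀ i, S.Adj i k → L i - L k < S.m i k) :
    (∀ i p, S.mesh (fun i p => if L i ≤ p then f i p else 0) i p =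
      if i = k ∧ p = L k then 1 else 0) ∧
    ∀ i p, L k - 2 * S.d i < p → f i p = if L i ≤ p then f i p else 0 := by
  set b : I → ℤ → ℤ := fun i p => if L i ≤ p then f i p else 0 with hb
  have hbe : ∀ i p, b i p = if L i ≤ p then f i p else 0 := fun _ _ => rfl
  have hbf : ∀ j q, L j - 2 * S.d j < q → b j q = f j q := by
    intro j q hq
    rw [hbe]
    split_ifs with h
    · rfl
    · exact (hwin j q hq (not_le.1 h)).symm
  have hb0 : ∀ j q, q < L j ∨ q ≤ L j ∧ j ≠ k → b j q = 0 := by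
    intro j q hq
    rw [hbe]
    split_ifs with h
    · have hq' : q = L j := by omega
      rw [hq', htop, if_neg (hq.resolve_left (not_lt.2 h)).2]
    · rfl
  have h1 : ∀ i p, S.mesh b i p = if i = k ∧ p = L k then 1 else 0 := by
    intro i p
    have hdi := S.d_pos i
    rcases lt_or_ge (L i) p with hp | hp
    · have : S.mesh b i p = S.mesh f i p := by
        refine S.mesh_congr (hbf _ _ (by omega)) (hbf _ _ (by omega)) fun j hj t ht => hbf _ _ ?_
        have e1 := S.add_eq i j hj
        have e2 := abs_le.1 (hL i j hj)
        omega
      rw [this, hf, if_neg]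
      rintro ⟨rfl, rfl⟩
      exact lt_irrefl _ hp
    · have : S.mesh b i p = b i p := by
        classical
        rw [mesh, hb0 i (p - 2 * S.d i) (Or.inl (by omega)), add_zero, sub_eq_self]
        refine Finset.sum_eq_zero fun j hj => Finset.sum_eq_zero fun t ht => hb0 _ _ ?_
        have hj : S.Adj i j := by simpa using hj
        have e2 := abs_le.1 (hL i j hj)
        by_cases hjk : j = k
        · subst hjk
          have := hk i hj
          left; omega
        · right
          exact ⟨by omega, hjk⟩
      rw [this]
      rcases hp.lt_or_eq with hp | rfl
      · rw [hb0 _ _ (Or.inl hp), if_neg]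
        rintro ⟨rfl, rfl⟩
        exact lt_irrefl _ hp
      · rw [hbe, if_pos le_rfl, htop]
        by_cases h : i = k
        · subst h; simp
        · simp [h]
  refine ⟨h1, fun i p hp => ?_⟩
  have h2 : ∀ i p, L k < p → S.mesh (fun i p => f i p - b i p) i p = 0 := by
    intro i p hp
    rw [mesh_sub, hf, h1, if_neg (by omega), sub_zero]
  obtain ⟨N, hN⟩ : ∃ N, ∀ i, L i ≤ N := by
    obtain ⟨N, hN⟩ := (Set.finite_range L).bddAbove
    exact ⟨N, fun i => hN ⟨i, rfl⟩⟩
  have h3 := S.eq_zero_of_mesh (f := fun i p => f i p - b i p) (N := N) (P := L k)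
    (fun i p hp => by rw [hbe, if_pos ((hN i).trans hp), sub_self]) h2 i
    (p := p + 2 * S.d i) (by omega)
  simp only [add_sub_cancel_right] at h3
  exact sub_eq_zero.1 h3

end MeshSystem

namespace QDatum

variable {V : Type*} [Fintype V] (Q : QDatum V)

/-- The mesh system of the folded diagram. -/
noncomputable def meshSystem : MeshSystem Q.Index where
  d i := Q.d i
  Adj := Q.IndexAdj
  m := Q.m
  n := Q.mult
  m_pos i j _ := by
    have h1 := Q.d_pos i
    have h2 := Q.d_pos j
    unfold m; omega
  add_eq i j _ := by
    have h1 := Q.d_pos i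
    have h2 := Q.d_pos j
    unfold m mult
    split_ifs with h
    · omega
    · have h3 : Q.d i = Q.r := by
        obtain ⟨v, rfl⟩ := Q.orb_surjective i
        exact Q.d_of_not_fixed fun hf => h (Q.d_of_fixed hf)
      have := Q.d_le_r j
      omega
  d_pos i := by exact_mod_cast Q.d_pos i

open Classical in
/-- The maximal heights of the orbits once the vertices in `A` have been read. -/
noncomputable def slice (A : List V) (i : Q.Index) : ℤ :=
  if Q.circ i ∈ A then Q.ht i - 2 else Q.ht i

variable {Q}

theorem IsAdapted.slice_le {A B : List V} {k : Q.Index} (hL : Q.IsAdapted (A ++ Q.circ k :: B))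
    {i j : Q.Index} (hij : Q.IndexAdj i j) : Q.slice A i ≤ Q.slice A j + Q.m i j := by
  have hp := hL.ht_le
  rw [List.pairwise_append] at hp
  have h := hp.2.2
  have habs : |Q.ht i - Q.ht j| ≤ Q.m i j := by
    obtain ⟨v, w, rfl, rfl, hvw⟩ := hij
    exact Q.abs_ht_sub_le hvw
  have habs := abs_le.1 habs
  have hji := hij.symm
  unfold slice
  split_ifs with h1 h2 h2
  · omega
  · omega
  · have hi : Q.circ i ∈ Q.circ k :: B :=
      (List.mem_append.1 ((hL.mem_iff _).2 (Q.circ_mem i))).resolve_left h1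
    have := h _ h2 _ hi
    rw [Q.orb_circ, Q.orb_circ, Q.m_comm j i] at this
    have := this hji
    omega
  · omega

theorem IsAdapted.slice_lt {A B : List V} {k : Q.Index} (hL : Q.IsAdapted (A ++ Q.circ k :: B))
    {i : Q.Index} (hik : Q.IndexAdj i k) : Q.slice A i - Q.slice A k < Q.m i k := by
  have hkA : Q.circ k ∉ A := fun h =>
    List.disjoint_of_nodup_append hL.nodup h List.mem_cons_self
  have hp := hL.ht_le
  rw [List.pairwise_append, List.pairwise_cons] at hp
  have habs : |Q.ht i - Q.ht k| ≤ Q.m i k := by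
    obtain ⟨v, w, rfl, rfl, hvw⟩ := hik
    exact Q.abs_ht_sub_le hvw
  have habs := abs_le.1 habs
  have hki := hik.symm
  unfold slice
  rw [if_neg hkA]
  split_ifs with h1
  · omega
  · have hi : Q.circ i ∈ Q.circ k :: B :=
      (List.mem_append.1 ((hL.mem_iff _).2 (Q.circ_mem i))).resolve_left h1
    rcases List.mem_cons.1 hi with hi | hi
    · obtain ⟨v, w, h2, h3, h4⟩ := hik
      have := Q.circ_injective hi
      exact absurd (by rw [h2, h3, this]) (Q.orb_ne_of_adj h4)
    · have := hp.2.1.1 _ hi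
      rw [Q.orb_circ, Q.orb_circ, Q.m_comm k i] at this
      have := this hki
      omega

variable [DecidableEq V]

theorem IsAdapted.mesh_pairing {L : List V} (hL : Q.IsAdapted L) (A : List V) (c : V)
    (i : Q.Index) (p : ℤ) : Q.meshSystem.mesh (Q.pairing L A c) i p = 0 := by
  classical
  have := congrArg (fun x => ((A.map Q.simpleReflection).prod⁻¹ x) c) (hL.mesh i p)
  simp only [map_add, map_sum, Pi.add_apply, Finset.sum_apply] at this
  exact sub_eq_zero.2 this

/-- On the slice reached after reading `A`, the weights are the translates `g ϖ_v` of all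
fundamental weights, and they pair with `g α_c` as `ϖ_v` with `α_c`. -/
theorem IsAdapted.pairing_slice {A B : List V} {k : Q.Index}
    (hL : Q.IsAdapted (A ++ Q.circ k :: B)) (j : Q.Index) {q : ℤ}
    (h1 : Q.slice A j - 2 * Q.d j < q) (h2 : q ≤ Q.slice A j) :
    Q.pairing (A ++ Q.circ k :: B) A (Q.circ k) j q =
      if j = k ∧ q = Q.slice A j then 1 else 0 := by
  classical
  set L := A ++ Q.circ k :: B with hLdef
  have hkA : Q.circ k ∉ A := fun h =>
    List.disjoint_of_nodup_append hL.nodup h List.mem_cons_self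
  have hgen : ∀ v, Q.weight (Q.coxeter L) j q = (A.map Q.simpleReflection).prod (Q.fundWeight v) →
      Q.pairing L A (Q.circ k) j q = if v = Q.circ k then 1 else 0 := by
    intro v hv
    rw [pairing, hv, ← LinearEquiv.mul_apply, inv_mul_cancel]
    simp [FoldedDiagram.fundWeight, Pi.single_apply, eq_comm]
  have hfix : ∀ v, v ∉ A → (A.map Q.simpleReflection).prod (Q.fundWeight v) = Q.fundWeight v :=
    fun v hv => Q.prod_simpleReflection_fundWeight hv
  by_cases hpar : (2 : ℤ) ∣ Q.ht j - q
  swap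
  · rw [pairing, weight, if_neg hpar, map_zero, Pi.zero_apply, if_neg]
    rintro ⟨-, rfl⟩
    unfold slice at hpar
    split_ifs at hpar
    · exact hpar ⟨1, by ring⟩
    · exact hpar ⟨0, by ring⟩
  obtain ⟨l, hl⟩ : ∃ l : ℕ, q = Q.ht j - 2 * l := by
    have : q ≤ Q.ht j := by
      unfold slice at h2
      split_ifs at h2 <;> omega
    exact ⟨((Q.ht j - q) / 2).toNat, by omega⟩
  by_cases hjA : Q.circ j ∈ A
  · have hjk : j ≠ k := fun h => hkA (h ▸ hjA)
    rw [slice, if_pos hjA] at h1 h2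
    rw [if_neg fun h => hjk h.1]
    rcases (show l ≤ Q.d j by omega).lt_or_eq with hld | hld
    · have hmem : (Q.σ ^ l) (Q.circ j) ∉ L := hL.pow_circ_notMem j (by omega) hld
      have hmemA : (Q.σ ^ l) (Q.circ j) ∉ A := fun h => hmem (List.mem_append_left _ h)
      rw [hgen _ (by rw [hl, hL.weight_of_lt j hld, hfix _ hmemA]), if_neg]
      intro h
      exact hmem (by rw [h, hLdef]; simp)
    · rw [hgen (Q.circ j) (by rw [hl, hld, hL.weight_d, Q.prefix_fundWeight hL.nodup hjA]),
        if_neg fun h => hjk (Q.circ_injective h)]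
  · rw [slice, if_neg hjA] at h1 h2 ⊢
    have hld : l < Q.d j := by omega
    have hmemA : (Q.σ ^ l) (Q.circ j) ∉ A := by
      rcases Nat.eq_zero_or_pos l with rfl | h0
      · simpa using hjA
      · exact fun h => hL.pow_circ_notMem j h0 hld (List.mem_append_left _ h)
    rw [hgen _ (by rw [hl, hL.weight_of_lt j hld, hfix _ hmemA])]
    have : (Q.σ ^ l) (Q.circ j) = Q.circ k ↔ j = k ∧ q = Q.ht j := by
      constructor
      · intro h
        have hjk : j = k := by
          have := congrArg Q.orb h
          rwa [Q.orb_pow, Q.orb_circ, Q.orb_circ] at this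
        subst hjk
        have := Q.pow_apply_inj_of_lt_d (v := Q.circ j) (k := l) (l := 0) (by simpa using hld)
          (by simpa using Q.d_pos j) (by simpa using h)
        exact ⟨rfl, by rw [hl, this]; simp⟩
      · rintro ⟨rfl, h⟩
        have : l = 0 := by omega
        rw [this]; rfl
    simp only [this]

/-- The truncated sequences form a column of the inverse of the quantum Cartan matrix. -/
theorem IsAdapted.truncated_pairing {A B : List V} {k : Q.Index}
    (hL : Q.IsAdapted (A ++ Q.circ k :: B)) :
    (∀ i p, Q.meshSystem.mesh (fun i p => if Q.slice A i ≤ p then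
        Q.pairing (A ++ Q.circ k :: B) A (Q.circ k) i p else 0) i p =
      if i = k ∧ p = Q.ht k then 1 else 0) ∧
    ∀ i p, Q.ht k - 2 * Q.d i < p → Q.pairing (A ++ Q.circ k :: B) A (Q.circ k) i p =
      if Q.slice A i ≤ p then Q.pairing (A ++ Q.circ k :: B) A (Q.circ k) i p else 0 := by
  have hkA : Q.circ k ∉ A := fun h =>
    List.disjoint_of_nodup_append hL.nodup h List.mem_cons_self
  have hk : Q.slice A k = Q.ht k := if_neg hkA
  rw [← hk]
  refine MeshSystem.truncation (S := Q.meshSystem) (hL.mesh_pairing A _) (fun j q h1 h2 => ?_)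
    (fun j => ?_) (fun i j hij => ?_) (fun i hik => hL.slice_lt hik)
  · rw [hL.pairing_slice j h1 h2.le, if_neg]
    rintro ⟨-, rfl⟩
    exact lt_irrefl _ h2
  · have := Q.d_pos j
    rw [hL.pairing_slice j (by omega) le_rfl]
    simp
  · have hji := hij.symm
    have h1 := hL.slice_le hij
    have h2 := hL.slice_le hji
    rw [Q.m_comm j i] at h2
    change |_| ≤ Q.m i j
    rw [abs_le]
    constructor <;> linarith

end QDatum

/-! ### The inverse quantum Cartan matrix -/

theorem RatFunc.X_sub_inv_ne_zero : (RatFunc.X - RatFunc.X⁻¹ : RatFunc ℚ) ≠ 0 := by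
  intro h
  have h1 : (RatFunc.X : RatFunc ℚ) * RatFunc.X = 1 := by
    nth_rewrite 2 [sub_eq_zero.1 h]
    exact mul_inv_cancel₀ RatFunc.X_ne_zero
  have h2 : (Polynomial.X * Polynomial.X : Polynomial ℚ) = 1 := by
    apply RatFunc.algebraMap_injective ℚ
    rw [map_mul, RatFunc.algebraMap_X, h1, map_one]
  have := congrArg Polynomial.natDegree h2
  simp at this

/-- `-[n]_z` as a Laurent polynomial. -/
theorem quantumInt_neg (n : ℕ) :
    quantumInt (-n) = -∑ t ∈ range n, (RatFunc.X : RatFunc ℚ) ^ (2 * (t : ℤ) - (n - 1)) := by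
  have hX : (RatFunc.X : RatFunc ℚ) ≠ 0 := RatFunc.X_ne_zero
  rw [quantumInt, div_eq_iff RatFunc.X_sub_inv_ne_zero, neg_mul, Finset.sum_mul]
  have : ∀ t ∈ range n, (RatFunc.X : RatFunc ℚ) ^ (2 * (t : ℤ) - (n - 1)) *
      (RatFunc.X - RatFunc.X⁻¹) = RatFunc.X ^ (2 * ((t + 1 : ℕ) : ℤ) - n) -
        RatFunc.X ^ (2 * (t : ℤ) - n) := by
    intro t _
    rw [mul_sub, ← zpow_add_one₀ hX, ← zpow_sub_one₀ hX]
    congr 2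
    · push_cast; ring
    · ring
  rw [Finset.sum_congr rfl this, Finset.sum_range_sub fun t : ℕ => (RatFunc.X : RatFunc ℚ) ^
    (2 * (t : ℤ) - n), neg_sub, neg_neg]
  congr 2 <;> push_cast <;> ring

/-- The Laurent expansion at `0` of a rational function. It is defined over a general field because
the synthesis of `Algebra (RatFunc ℚ) (LaurentSeries ℚ)` fails on the ring structure of `ℚ`. -/
noncomputable def RatFunc.laurentExpansion (K : Type*) [Field K] :
    RatFunc K →+* LaurentSeries K := algebraMap _ _

theorem RatFunc.laurentExpansion_X (K : Type*) [Field K] :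
    RatFunc.laurentExpansion K RatFunc.X = HahnSeries.single 1 1 := RatFunc.coe_X

/-- The Laurent expansion at `0` of a rational function with rational coefficients. -/
noncomputable def ratLaurent : RatFunc ℚ →+* LaurentSeries ℚ := RatFunc.laurentExpansion ℚ

theorem coeff_ratLaurent_zpow_mul (k : ℤ) (b : LaurentSeries ℚ) (u : ℤ) :
    (ratLaurent (RatFunc.X ^ k) * b).coeff u = b.coeff (u - k) := by
  have h : ratLaurent RatFunc.X = HahnSeries.single 1 1 := RatFunc.laurentExpansion_X ℚ
  rw [map_zpow₀, h, ← RatFunc.single_zpow, HahnSeries.coeff_single_mul, one_mul]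

namespace QDatum

variable {V : Type*} [Fintype V] (Q : QDatum V)

theorem c_eq_neg_mult {i j : Q.Index} (h : Q.IndexAdj i j) : Q.c i j = -(Q.mult i j : ℤ) := by
  classical
  have hne : i ≠ j := by
    obtain ⟨v, w, rfl, rfl, hvw⟩ := h
    exact (Q.orb_ne_of_adj hvw).symm
  rw [FoldedDiagram.c, if_neg hne, if_pos h, mult]
  congr 1
  have h1 := Q.d_pos i
  have h2 := Q.d_pos j
  split_ifs with hd
  · rw [hd]; simp
  · have hr : Q.d i = Q.r := by
      obtain ⟨v, rfl⟩ := Q.orb_surjective i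
      exact Q.d_of_not_fixed fun hf => hd (Q.d_of_fixed hf)
    have hle : (Q.d j : ℚ) ≤ Q.d i := by
      rw [hr]; exact_mod_cast Q.d_le_r j
    have h1' : (0 : ℚ) < Q.d i := by exact_mod_cast h1
    have h2' : (0 : ℚ) < Q.d j := by exact_mod_cast h2
    rw [Int.ceil_eq_iff]
    refine ⟨?_, ?_⟩
    · have := div_pos h2' h1'
      simpa using this
    · simpa using (div_le_one h1').2 hle

open Classical in
/-- The product of the quantum Cartan matrix with a column of Laurent series, whose degrees are
heights shifted by `d j - N`, is the defect in the mesh relation. -/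
theorem coeff_sum_quantumCartan_mul (b : Q.Index → LaurentSeries ℚ) (g : Q.Index → ℤ → ℤ) (N : ℤ)
    (hb : ∀ j u, (b j).coeff u = g j (u + N - Q.d j)) (i : Q.Index) (u : ℤ) :
    (∑ j, ratLaurent (Q.quantumCartan i j) * b j).coeff u =
      Q.meshSystem.mesh g i (u + N) := by
  have hoff : ∀ j ∈ univ.erase i, ratLaurent
      (Q.quantumCartan i j) * b j = if Q.IndexAdj i j then
        -∑ t ∈ range (Q.mult i j), ratLaurent
          (RatFunc.X ^ (2 * (t : ℤ) - (Q.mult i j - 1))) * b j else 0 := by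
    intro j hj
    have hij : i ≠ j := (Finset.ne_of_mem_erase hj).symm
    rw [FoldedDiagram.quantumCartan, Matrix.of_apply, if_neg hij]
    split_ifs with h
    · rw [Q.c_eq_neg_mult h, quantumInt_neg, map_neg, neg_mul, map_sum, Finset.sum_mul]
    · rw [FoldedDiagram.c, if_neg hij, if_neg h]
      simp [quantumInt]
  have hii : ¬ Q.IndexAdj i i := by
    rintro ⟨v, w, h1, h2, h3⟩
    exact Q.orb_ne_of_adj h3 (h2.trans h1.symm)
  rw [← Finset.add_sum_erase _ _ (Finset.mem_univ i), Finset.sum_congr rfl hoff,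
    Finset.sum_erase _ (by rw [if_neg hii]), ← Finset.sum_filter]
  rw [FoldedDiagram.quantumCartan, Matrix.of_apply, if_pos rfl, map_add, add_mul,
    HahnSeries.coeff_add, HahnSeries.coeff_add, coeff_ratLaurent_zpow_mul,
    coeff_ratLaurent_zpow_mul, hb, hb, Finset.sum_neg_distrib, HahnSeries.coeff_neg,
    HahnSeries.coeff_sum, MeshSystem.mesh]
  push_cast
  have e : ∀ j ∈ univ.filter (Q.IndexAdj i), (∑ t ∈ range (Q.mult i j),
      ratLaurent (RatFunc.X ^ (2 * (t : ℤ) - (Q.mult i j - 1))) *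
        b j).coeff u = ∑ t ∈ range (Q.mult i j), (g j (u + N - Q.m i j - 2 * t) : ℚ) := by
    intro j hj
    have hj : Q.IndexAdj i j := by simpa using hj
    have hm : Q.m i j + Q.mult i j = Q.d j + 1 := Q.meshSystem.add_eq i j hj
    rw [HahnSeries.coeff_sum]
    refine Finset.sum_congr rfl fun t _ => ?_
    rw [coeff_ratLaurent_zpow_mul, hb]
    congr 2
    linarith
  rw [Finset.sum_congr rfl e, ← sub_eq_add_neg, add_comm ((g i _ : ℤ) : ℚ)]
  have e1 : u - (Q.d i : ℤ) + N - Q.d i = u + N - 2 * Q.d i := by ring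
  have e2 : u - -(Q.d i : ℤ) + N - Q.d i = u + N := by ring
  rw [e1, e2]
  rfl

variable [DecidableEq V]

variable {Q} in
/-- The truncated pairings with the roots of all orbits form a matrix `Bm` of Laurent series with
`C Bm = 1`; in particular `C` is invertible, and its inverse expands to `Bm`. -/
theorem IsAdapted.invQuantumCartanCoeff_eq {L : List V} (hL : Q.IsAdapted L) (i k : Q.Index)
    {A B : List V} (hAB : L = A ++ Q.circ k :: B) (u : ℤ) :
    Q.invQuantumCartanCoeff i k u =
      ((if Q.slice A i ≤ u + Q.ht k - Q.d i then
        Q.pairing L A (Q.circ k) i (u + Q.ht k - Q.d i) else 0 : ℤ) : ℚ) := by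
  classical
  -- every column needs a splitting of the list at its own vertex; for `k` it is the given one
  have hsplit : ∀ k, ∃ AB : List V × List V, L = AB.1 ++ Q.circ k :: AB.2 := fun k => by
    obtain ⟨A, B, h⟩ := List.mem_iff_append.1 ((hL.mem_iff _).2 (Q.circ_mem k))
    exact ⟨(A, B), h⟩
  choose AB hABk using hsplit
  have hAk : (AB k).1 = A := by
    have h1 := hABk k
    have hn1 : Q.circ k ∉ (AB k).1 := fun h =>
      List.disjoint_of_nodup_append (h1 ▸ hL.nodup) h List.mem_cons_self
    have hn2 : Q.circ k ∉ A := fun h =>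
      List.disjoint_of_nodup_append (hAB ▸ hL.nodup) h List.mem_cons_self
    rw [hAB] at h1
    have e1 := congrArg (List.takeWhile (fun x => decide (x ≠ Q.circ k))) h1
    rw [List.takeWhile_append_of_pos (by
        intro a ha; simp only [ne_eq, decide_not, Bool.not_eq_true', decide_eq_false_iff_not]
        rintro rfl; exact hn2 ha),
      List.takeWhile_append_of_pos (by
        intro a ha; simp only [ne_eq, decide_not, Bool.not_eq_true', decide_eq_false_iff_not]
        rintro rfl; exact hn1 ha)] at e1
    simpa using e1.symm
  let g : Q.Index → Q.Index → ℤ → ℤ := fun k j p =>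
    if Q.slice (AB k).1 j ≤ p then Q.pairing L (AB k).1 (Q.circ k) j p else 0
  have hsupp : ∀ j k, BddBelow (Function.support fun u : ℤ =>
      (g k j (u + Q.ht k - Q.d j) : ℚ)) := by
    intro j k
    refine ⟨Q.slice (AB k).1 j - Q.ht k + Q.d j, fun u hu => ?_⟩
    by_contra hc
    refine hu ?_
    simp only [g]
    rw [if_neg (by omega), Int.cast_zero]
  let Bm : Matrix Q.Index Q.Index (LaurentSeries ℚ) :=
    Matrix.of fun j k => HahnSeries.ofSuppBddBelow _ (hsupp j k)
  have hBm : ∀ j k u, (Bm j k).coeff u = (g k j (u + Q.ht k - Q.d j) : ℚ) := fun j k u => by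
    simp only [Bm, Matrix.of_apply, HahnSeries.coeff_ofSuppBddBelow]
  have hmul : Q.quantumCartan.map ratLaurent * Bm = 1 := by
    ext i k u
    have hLk : Q.IsAdapted ((AB k).1 ++ Q.circ k :: (AB k).2) := hABk k ▸ hL
    have h1 := hLk.truncated_pairing.1 i (u + Q.ht k)
    rw [← hABk k] at h1
    have h2 := Q.coeff_sum_quantumCartan_mul (fun j => Bm j k) (g k) (Q.ht k)
      (fun j u => hBm j k u) i u
    rw [Matrix.mul_apply]
    simp only [Matrix.map_apply]
    rw [h2]
    simp only [g]
    rw [h1, Matrix.one_apply]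
    by_cases hik : i = k
    · by_cases hu : u = 0
      · simp [hik, hu]
      · simp [hik, hu, HahnSeries.coeff_one]
    · simp [hik]
  have hdet : IsUnit Q.quantumCartan.det := by
    rw [isUnit_iff_ne_zero]
    intro h0
    have h1 : (Q.quantumCartan.map ratLaurent).det = 0 := by
      rw [← RingHom.mapMatrix_apply, ← RingHom.map_det, h0, map_zero]
    have h2 := congrArg Matrix.det hmul
    rw [Matrix.det_mul, h1, zero_mul, Matrix.det_one] at h2
    exact zero_ne_one h2
  have hinv : (Q.quantumCartan⁻¹).map ratLaurent = Bm := by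
    have h1 : (Q.quantumCartan⁻¹).map ratLaurent * Q.quantumCartan.map ratLaurent = 1 := by
      rw [← Matrix.map_mul, Matrix.nonsing_inv_mul _ hdet,
        Matrix.map_one _ (map_zero ratLaurent) (map_one ratLaurent)]
    calc (Q.quantumCartan⁻¹).map ratLaurent =
          (Q.quantumCartan⁻¹).map ratLaurent * (Q.quantumCartan.map ratLaurent * Bm) := by
          rw [hmul, mul_one]
      _ = Bm := by rw [← mul_assoc, h1, one_mul]
  have h := congrFun (congrFun hinv i) k
  rw [Matrix.map_apply] at h
  change (ratLaurent (Q.quantumCartan⁻¹ i k)).coeff u = _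
  rw [h, hBm]
  simp only [g, hAk]

end QDatum

end

theorem mainTheorem1 {V : Type*} [Fintype V] [DecidableEq V] (Q : QDatum V)
    (τ : (V → ℤ) ≃ₗ[ℤ] (V → ℤ)) (hτ : Q.IsGenTwistedCoxeter τ)
    (i j : Q.Index) (v w : V) (hv : Q.orb v = i) (hw : Q.orb w = j) (u : ℕ) :
    Q.invQuantumCartanCoeff i j (u : ℤ) =
      if (2 : ℤ) ∣ (u : ℤ) + Q.ξ w - Q.ξ v - (Q.d i : ℤ) then
        Q.form (Q.fundWeight v)
          ((τ ^ (((u : ℤ) + Q.ξ w - Q.ξ v - (Q.d i : ℤ)) / 2)) (Q.γ τ w))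
      else 0 := by
  obtain ⟨w₀, w₁, ⟨l₀, hl₀, hw₀⟩, ⟨l₁, hl₁, hw₁⟩, hτ⟩ := hτ
  have hL := Q.isAdapted_of_reading hl₀
  obtain ⟨A, B, hAB⟩ := List.mem_iff_append.1 ((hL.mem_iff _).2 (Q.circ_mem j))
  have hcox : w₀ * Q.sigmaAut = Q.coxeter (A ++ Q.circ j :: B) := by
    rw [← hAB, hw₀, QDatum.coxeter, List.map_map]
    rfl
  rw [hcox] at hτ
  have hL' := hAB ▸ hL
  subst hv
  rw [hL'.form_eq_pairing hl₁ hw₁ hτ hw, hL'.invQuantumCartanCoeff_eq _ j rfl]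
  have := Q.d_pos (Q.orb v)
  rw [← hL'.truncated_pairing.2 _ _ (by omega)]
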